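/- **Notation.** For $A=\begin{pmatrix}a&b\\c&d\end{pmatrix}\in M_2(\mathbb R)$ let $$CD(A)=\overline D\Big(\tfrac{a+d}{2}+\tfrac{c-b}{2}\,i,\ \sqrt{\big(\tfrac{a-d}{2}\big)^2+\big(\tfrac{b+c}{2}\big)^2}\Big)\subset\mathbb C$$ (the chiral disk, a possibly degenerate closed disk), where $\overline D(z,r)$ and $D(z,r)$ denote the closed and the open disk with center $z$ and radius $r$. Let $\tilde I=\begin{pmatrix}0&-1\\1&0\end{pmatrix}$, $\tilde J=\begin{pmatrix}1&0\\0&-1\end{pmatrix}$, $\tilde K=\begin{pmatrix}0&1\\1&0\end{pmatrix}$, and let $\tilde{\mathbb K}=\{-\sin\beta\,\tilde J+\cos\beta\,\tilde K:\beta\in[0,2\pi)\}$ be the set of orthogonal conjugates of $\tilde K$. For real $p_1,p_2,t$ and $\tilde F\in\tilde{\mathbb K}$ put $$NW(p_1,p_2,t,\tilde F)=e^{p_1\cos t}\Big[\exp\big((p_1+p_2)\sin t\,\tilde I\big)\Big(\cosh(p_2\cos t)\,\mathrm{Id}-\tfrac{\sinh(p_2\cos t)}{\cos t}\sin t\,\tilde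 I\Big)+\tfrac{\sinh(p_2\cos t)}{\cos t}\,\tilde F\Big],$$ where $\frac{\sinh(p_2\cos t)}{\cos t}$ is read as $p_2$ when $\cos t=0$. For a matrix-valued density $h$ on $[a,b]$, $$\exp_L(h\,d\theta|_{[a,b]})=\mathrm{Id}+\sum_{k\ge1}\int_{a\le\theta_1\le\dots\le\theta_k\le b}h(\theta_k)\cdots h(\theta_1)\,d\theta_1\cdots d\theta_k$$ is the left time-ordered exponential, and $\int_a^b\|h(\theta)\|_2\,d\theta$ is the total variation, $\|\cdot\|_2$ being the Euclidean operator norm. **Theorem.** Let $A\in M_2(\mathbb R)$ with $CD(A)\subset\exp D(0,\pi)$. Then there is a smallest real number $p$ such that $CD(A)\subset\exp\overline D(0,p)$, and $CD(A)$ contains $e^{p(\cos t+i\sin t)}$ for some $t\in\mathbb R$. Moreover: 1. For every $t\in\mathbb R$ with $e^{p(\cos t+i\sin t)}\in CD(A)$ there are $p_1,p_2\ge0$ with $p_1+p_2=p$ and $\tilde F\in\tilde{\mathbb K}$ such that $$\begin{aligned}A&=NW(p_1,p_2,t,\tilde F)\\ &=\exp_L\big((p_1\exp(t\tilde I)+p_2\exp(2p\theta\sin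 t\,\tilde I)\tilde F)\,d\theta|_{[-1/2,1/2]}\big)\\ &=\exp_L\big(\exp(t\tilde I)\,d\theta|_{[0,p_1]}\big)\,\exp_L\big(\exp((2\theta-p_1-p_2)\sin t\,\tilde I)\tilde F\,d\theta|_{[0,p_2]}\big)\\ &=\exp_L\big(\exp((2\theta+p_1-p_2)\sin t\,\tilde I)\tilde F\,d\theta|_{[0,p_2]}\big)\,\exp_L\big(\exp(t\tilde I)\,d\theta|_{[0,p_1]}\big).\end{aligned}$$ The measure in the second line has total variation $p$. In the last two lines, the measures on $[0,p_1]$ and $[0,p_2]$ have total variation $p_1$ and $p_2$, respectively. The factor over $[0,p_1]$ is the exponential $\exp(p_1\exp(t\tilde I))$, and the densities over $[0,p_2]$ are, up to conjugation by a fixed rotation, the density $\begin{pmatrix}-\sin(2\theta\sin t)&\cos(2\theta\sin t)\\\cos(2\theta\sin t)&\sin(2\theta\sin t)\end{pmatrix}$ of a hyperbolic (or, if $\cos t=0$, parabolic) development. 2. Call $(p_1,p_2,t,\tilde F)$ a presentation of $A$ if $p_1,p_2\ge0$, $p_1+p_2<\pi$, $t\in\mathbb R$, $\tilde F\in\tilde{\mathbb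 K}$ and $A=NW(p_1,p_2,t,\tilde F)$. For every presentation $(p_1,p_2,t,\tilde F)$ of $A$: * $p_1=p_2=0$ if and only if $A=\mathrm{Id}$. * $p_1>0,\ p_2=0$ if and only if $A\ne\mathrm{Id}$ and $CD(A)$ is a single point; if $p_2=0$, then $A=NW(p_1,p_2,t,\tilde F')$ for every $\tilde F'\in\tilde{\mathbb K}$. * $p_1=0,\ p_2>0$ if and only if $A\ne\mathrm{Id}$ and $CD(A)$ is maximal among the closed disks contained in $\exp\overline D(0,p)$; in this case the presentations of $A$ are exactly $(0,p_2,s,\tilde F)$ with $s\equiv t$ or $s\equiv\pi-t$ modulo $2\pi$. * If $p_1,p_2>0$, the presentation is unique: every presentation $(q_1,q_2,s,\tilde G)$ of $A$ satisfies $q_1=p_1$, $q_2=p_2$, $s\equiv t$ modulo $2\pi$ and $\tilde G=\tilde F$. -/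

import Mathlib

open scoped Matrix.Norms.L2Operator

noncomputable section

namespace MagnusGL2

/-- Real `2 × 2` matrices. They carry the operator norm coming from the Euclidean norm
on `ℝ²` (the scoped instances opened above). -/
abbrev M2 : Type := Matrix (Fin 2) (Fin 2) ℝ

/-- The matrix `Ĩ`, the rotation by `π / 2`. -/
def tI : M2 := !![0, -1; 1, 0]

/-- The matrix `J̃`. -/
def tJ : M2 := !![1, 0; 0, -1]

/-- The matrix `K̃`. -/
def tK : M2 := !![0, 1; 1, 0]

/-- The set of the orthogonal conjugates of `K̃`. -/
def KK : Set M2 :=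
  {F | ∃ β : ℝ, 0 ≤ β ∧ β < 2 * Real.pi ∧ F = (-Real.sin β) • tJ + Real.cos β • tK}

/-- Center of the chiral disk of `A = [a, b; c, d]`: the number `(a + d)/2 + ((c - b)/2) i`. -/
def chiralCenter (A : M2) : ℂ :=
  ⟨(A 0 0 + A 1 1) / 2, (A 1 0 - A 0 1) / 2⟩

/-- Radius of the chiral disk of `A = [a, b; c, d]`. -/
def chiralRadius (A : M2) : ℝ :=
  Real.sqrt (((A 0 0 - A 1 1) / 2) ^ 2 + ((A 0 1 + A 1 0) / 2) ^ 2)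

/-- The chiral disk `CD(A)`, a possibly degenerate closed disk in the complex plane. -/
def CD (A : M2) : Set ℂ :=
  Metric.closedBall (chiralCenter A) (chiralRadius A)

/-- The image of the closed disk of center `0` and radius `r` under the complex exponential. -/
def expDisk (r : ℝ) : Set ℂ :=
  Complex.exp '' Metric.closedBall (0 : ℂ) r

/-- `D` is a maximal element among the (possibly degenerate) closed disks contained in `S`. -/
def IsMaximalDisk (D S : Set ℂ) : Prop :=
  (∃ (c : ℂ) (r : ℝ), 0 ≤ r ∧ D = Metric.closedBall c r) ∧ D ⊆ S ∧
    ∀ (c : ℂ) (r : ℝ), 0 ≤ r → D ⊆ Metric.closedBall c r → Metric.closedBall c r ⊆ S →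
      Metric.closedBall c r = D

/-- The function `sinh (x c) / c`, extended continuously by the value `x` at `c = 0`. -/
def sinhDiv (x c : ℝ) : ℝ :=
  if c = 0 then x else Real.sinh (x * c) / c

/-- The normal form `NW(p₁, p₂, t, F)`, that is,
`e^{p₁ cos t} (exp((p₁+p₂) sin t Ĩ) (cosh(p₂ cos t) Id - (sinh(p₂ cos t)/cos t) sin t Ĩ)
+ (sinh(p₂ cos t)/cos t) F)`. -/
def NW (p₁ p₂ t : ℝ) (F : M2) : M2 :=
  Real.exp (p₁ * Real.cos t) •
    (NormedSpace.exp (((p₁ + p₂) * Real.sin t) • tI) *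
        (Real.cosh (p₂ * Real.cos t) • (1 : M2)
          - (sinhDiv p₂ (Real.cos t) * Real.sin t) • tI)
      + sinhDiv p₂ (Real.cos t) • F)

/-- The `k`-th term of the left time-ordered exponential of `h(θ) dθ` on `[a, x]`, i.e. the
integral of `h(θ_k) ⋯ h(θ_1)` over `a ≤ θ_1 ≤ ⋯ ≤ θ_k ≤ x`, as an iterated integral. -/
def leftTerm (h : ℝ → M2) (a : ℝ) : ℕ → ℝ → M2
  | 0, _ => 1
  | k + 1, x => ∫ θ in a..x, h θ * leftTerm h a k θ

/-- The left time-ordered exponential of the measure `h(θ) dθ` restricted to `[a, b]`. -/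
def leftExp (h : ℝ → M2) (a b : ℝ) : M2 :=
  ∑' k : ℕ, leftTerm h a k b

/-- The total variation of the measure `h(θ) dθ` restricted to `[a, b]`. -/
def variation (h : ℝ → M2) (a b : ℝ) : ℝ :=
  ∫ θ in a..b, ‖h θ‖

/-- The constant density `exp(t Ĩ)` of a complex-exponential part. -/
def ellipticDensity (t : ℝ) : ℝ → M2 :=
  fun _ => NormedSpace.exp (t • tI)

/-- The density `exp((2 θ + s) sin t Ĩ) F`. -/
def developmentDensity (t s : ℝ) (F : M2) : ℝ → M2 :=
  fun θ => NormedSpace.exp (((2 * θ + s) * Real.sin t) • tI) * F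

/-- The density of the standard Magnus development of speed `v`
(parabolic for `v = ± 1`, strictly hyperbolic for `-1 < v < 1`). -/
def standardDevelopment (v : ℝ) : ℝ → M2 :=
  fun θ => !![-Real.sin (2 * (θ * v)), Real.cos (2 * (θ * v));
              Real.cos (2 * (θ * v)), Real.sin (2 * (θ * v))]

/-- `h` is the density of a Magnus development of speed `v` up to conjugation
by a rotation. -/
def IsDevelopment (v : ℝ) (h : ℝ → M2) : Prop :=
  ∃ Q ∈ Matrix.specialOrthogonalGroup (Fin 2) ℝ,
    ∀ θ : ℝ, h θ = Q * standardDevelopment v θ * Matrix.transpose Q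

/-- The density `p₁ exp(t Ĩ) + p₂ exp(2 (p₁ + p₂) θ sin t Ĩ) F`. -/
def uniformDensity (p₁ p₂ t : ℝ) (F : M2) : ℝ → M2 :=
  fun θ => p₁ • NormedSpace.exp (t • tI)
    + p₂ • (NormedSpace.exp ((2 * (p₁ + p₂) * θ * Real.sin t) • tI) * F)

/-- The quadruple `(p₁, p₂, t, F)` presents `A` in normal form, in the range `p₁ + p₂ < π`. -/
structure Presents (A : M2) (p₁ p₂ t : ℝ) (F : M2) : Prop where
  nonneg_left : 0 ≤ p₁
  nonneg_right : 0 ≤ p₂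
  lt_pi : p₁ + p₂ < Real.pi
  mem_KK : F ∈ KK
  eq_NW : A = NW p₁ p₂ t F

end MagnusGL2

end

namespace MagnusGL2

open Filter Topology

/-! ### Complex numbers as matrices and reflections -/

/-! Split a real matrix into its complex-linear and conjugate-linear parts, `A = conf w + r • F`
with `F` a reflection and `r ≥ 0`; then `CD A` is the disk of center `w` and radius `r`, so `A`
amounts to a disk together with a reflection (arbitrary if `r = 0`). In these terms
(`NW_eq_conf_add`) the disk of `NW p₁ p₂ t F` is internally tangent, at angle `t`, to the boundary
curve of `exp D̄(0, p)`, where `p = p₁ + p₂`. With `p` and `t` fixed, its radius grows strictly from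
`0` to `S = sinhDiv p (cos t)` as `p₂` runs from `0` to `p`. The theorem thus becomes plane geometry
of disks touching that curve.

Three facts carry it. A disk in `exp D̄(0, p)` that reaches the curve at `t` is tangent there and
has radius at most `S` (`tangent_of_subset_expDisk`); this gives existence, with `p` the maximum of
`|log|` on `CD A`. The tangent disk of radius `S` does lie in `exp D̄(0, p)`
(`tangentDisk_sinhDiv_subset`). It meets the curve only at angles with the same sine
(`sin_eq_of_boundary_mem`), and a smaller tangent disk meets it only at `t`; this gives uniqueness.

The last two facts rest on one inequality. The squared distance from a curve point of angle `t'` to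
the center of the maximal disk exceeds `S ^ 2` by a positive multiple of `cosh (p cos t') -
tangentFun p t (sin t')`. Nonnegativity follows by sliding the point of tangency from `t` to `t'`,
with a separate argument when the phase `p |sin t' - sin t|` exceeds `π` (`tangentFun_lt`).

The product formulas are independent of this geometry: each density is constant in a rotating frame,
so its time-ordered exponential is explicit (`leftExp_rotating`). -/

theorem tI_mul_tI : tI * tI = -1 := by
  ext i j; fin_cases i <;> fin_cases j <;> simp [tI]

/-- The embedding of `ℂ` in the real `2 × 2` matrices that sends `i` to `Ĩ`. -/
def conf : ℂ →ₐ[ℝ] M2 := Complex.lift ⟨tI, tI_mul_tI⟩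

theorem conf_apply (z : ℂ) : conf z = !![z.re, -z.im; z.im, z.re] := by
  have h : conf z = algebraMap ℝ M2 z.re + z.im • tI := Complex.liftAux_apply tI tI_mul_tI z
  rw [h, Algebra.algebraMap_eq_smul_one]
  ext i j; fin_cases i <;> fin_cases j <;> simp [tI]

theorem continuous_conf : Continuous conf :=
  conf.toLinearMap.continuous_of_finiteDimensional

theorem conf_ofReal (x : ℝ) : conf (x : ℂ) = x • (1 : M2) :=
  (conf.commutes x).trans (Algebra.algebraMap_eq_smul_one x)

theorem conf_mul_I (x : ℝ) : conf (x * Complex.I) = x • tI := by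
  ext i j; fin_cases i <;> fin_cases j <;> simp [conf_apply, tI]

theorem conf_ofReal_mul (x : ℝ) (z : ℂ) : conf (x * z) = x • conf z := by
  rw [← Complex.real_smul, map_smul]

theorem exp_conf (z : ℂ) : NormedSpace.exp (conf z) = conf (Complex.exp z) := by
  rw [Complex.exp_eq_exp_ℂ, NormedSpace.map_exp conf continuous_conf]

theorem exp_smul_tI (x : ℝ) :
    NormedSpace.exp (x • tI) = conf (Complex.exp (x * Complex.I)) := by
  rw [← conf_mul_I, exp_conf]

theorem mem_KK_iff {F : M2} :
    F ∈ KK ↔ ∃ x y : ℝ, x ^ 2 + y ^ 2 = 1 ∧ F = !![x, y; y, -x] := by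
  constructor
  · rintro ⟨β, -, -, rfl⟩
    refine ⟨-Real.sin β, Real.cos β, by simp, ?_⟩
    ext i j; fin_cases i <;> fin_cases j <;> simp [tJ, tK]
  · rintro ⟨x, y, h, rfl⟩
    set z : ℂ := ⟨y, -x⟩ with hz
    have hz1 : ‖z‖ = 1 := by
      have : Complex.normSq z = 1 := by rw [Complex.normSq_apply]; simp [hz]; nlinarith
      rw [Complex.normSq_eq_norm_sq] at this
      nlinarith [norm_nonneg z]
    have hz0 : z ≠ 0 := by intro h0; rw [h0] at hz1; simp at hz1
    have hc : Real.cos z.arg = y := by rw [Complex.cos_arg hz0, hz1]; simp [hz]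
    have hs : Real.sin z.arg = -x := by rw [Complex.sin_arg, hz1]; simp [hz]
    refine ⟨toIcoMod Real.two_pi_pos 0 z.arg, (toIcoMod_mem_Ico _ _ _).1, ?_, ?_⟩
    · simpa using (toIcoMod_mem_Ico Real.two_pi_pos 0 z.arg).2
    · have h1 : toIcoMod Real.two_pi_pos 0 z.arg
          = z.arg - toIcoDiv Real.two_pi_pos 0 z.arg * (2 * Real.pi) := by
        rw [toIcoMod]; simp
      rw [h1, Real.sin_sub_int_mul_two_pi, Real.cos_sub_int_mul_two_pi, hc, hs]
      ext i j; fin_cases i <;> fin_cases j <;> simp [tJ, tK]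

theorem KK.mul_self {F : M2} (hF : F ∈ KK) : F * F = 1 := by
  obtain ⟨x, y, h, rfl⟩ := mem_KK_iff.1 hF
  ext i j; fin_cases i <;> fin_cases j <;> simp <;> nlinarith

/-- Reflections are conjugate-linear. This rule moves every rotation past `F` in the matrix
computations below. -/
theorem KK.mul_conf {F : M2} (hF : F ∈ KK) (z : ℂ) :
    F * conf z = conf (starRingEnd ℂ z) * F := by
  obtain ⟨x, y, h, rfl⟩ := mem_KK_iff.1 hF
  ext i j; fin_cases i <;> fin_cases j <;> simp [conf_apply] <;> ring

theorem KK.conf_mul_mem {F : M2} (hF : F ∈ KK) {z : ℂ} (hz : ‖z‖ = 1) : conf z * F ∈ KK := by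
  obtain ⟨x, y, h, rfl⟩ := mem_KK_iff.1 hF
  have h1 : z.re * z.re + z.im * z.im = 1 := by
    rw [← Complex.normSq_apply, Complex.normSq_eq_norm_sq, hz]; norm_num
  refine mem_KK_iff.2 ⟨z.re * x - z.im * y, z.re * y + z.im * x, ?_, ?_⟩
  · linear_combination (x ^ 2 + y ^ 2) * h1 + h
  · ext i j; fin_cases i <;> fin_cases j <;> simp [conf_apply] <;> ring

theorem KK.one_add_ne_zero {F : M2} (hF : F ∈ KK) : 1 + F ≠ 0 := by
  obtain ⟨x, y, h, rfl⟩ := mem_KK_iff.1 hF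
  intro h0
  have h1 := congrFun (congrFun h0 0) 0
  have h2 := congrFun (congrFun h0 1) 1
  simp at h1 h2
  linarith

theorem chiralCenter_conf_add {F : M2} (hF : F ∈ KK) (w : ℂ) (r : ℝ) :
    chiralCenter (conf w + r • F) = w := by
  obtain ⟨x, y, h, rfl⟩ := mem_KK_iff.1 hF
  apply Complex.ext
  · simp [chiralCenter, conf_apply]; ring
  · simp [chiralCenter, conf_apply]

theorem chiralRadius_conf_add {F : M2} (hF : F ∈ KK) (w : ℂ) {r : ℝ} (hr : 0 ≤ r) :
    chiralRadius (conf w + r • F) = r := by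
  obtain ⟨x, y, h, rfl⟩ := mem_KK_iff.1 hF
  conv_rhs => rw [← Real.sqrt_sq hr]
  rw [chiralRadius]
  congr 1
  simp [conf_apply]
  linear_combination (r ^ 2) * h

theorem CD_conf_add {F : M2} (hF : F ∈ KK) (w : ℂ) {r : ℝ} (hr : 0 ≤ r) :
    CD (conf w + r • F) = Metric.closedBall w r := by
  rw [CD, chiralCenter_conf_add hF, chiralRadius_conf_add hF w hr]

theorem exists_eq_conf_add (A : M2) :
    ∃ F ∈ KK, A = conf (chiralCenter A) + chiralRadius A • F := by
  set u := (A 0 0 - A 1 1) / 2 with hu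
  set v := (A 0 1 + A 1 0) / 2 with hv
  have hr : chiralRadius A ^ 2 = u ^ 2 + v ^ 2 := Real.sq_sqrt (by positivity)
  -- For a degenerate disk the reflection has coefficient zero, and any element of `KK` serves.
  by_cases h0 : chiralRadius A = 0
  · refine ⟨!![1, 0; 0, -1], mem_KK_iff.2 ⟨1, 0, by norm_num, rfl⟩, ?_⟩
    rw [h0] at hr
    have hu0 : u = 0 := by nlinarith [sq_nonneg u, sq_nonneg v]
    have hv0 : v = 0 := by nlinarith [sq_nonneg u, sq_nonneg v]
    rw [h0]
    ext i j; fin_cases i <;> fin_cases j <;> simp [conf_apply, chiralCenter] <;> linarith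
  · refine ⟨!![u / chiralRadius A, v / chiralRadius A; v / chiralRadius A, -(u / chiralRadius A)],
      mem_KK_iff.2 ⟨_, _, ?_, rfl⟩, ?_⟩
    · field_simp; linarith
    · ext i j; fin_cases i <;> fin_cases j <;>
        simp [conf_apply, chiralCenter, mul_div_cancel₀ _ h0] <;> linarith

theorem chiralRadius_nonneg (A : M2) : 0 ≤ chiralRadius A := Real.sqrt_nonneg _

/-! ### The normal form in terms of its center and its radius -/

/-- The unit complex number of angle `t`. -/
noncomputable def dir (t : ℝ) : ℂ := Real.cos t + Real.sin t * Complex.I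

theorem dir_eq_exp (t : ℝ) : dir t = Complex.exp (t * Complex.I) := by
  rw [dir, Complex.exp_mul_I]; simp

@[simp] theorem dir_re (t : ℝ) : (dir t).re = Real.cos t := by
  simp [dir, Complex.cos_ofReal_re, Complex.sin_ofReal_im]

@[simp] theorem dir_im (t : ℝ) : (dir t).im = Real.sin t := by
  simp [dir, Complex.cos_ofReal_im, Complex.sin_ofReal_re]

theorem norm_dir (t : ℝ) : ‖dir t‖ = 1 := by
  rw [dir_eq_exp, Complex.norm_exp_ofReal_mul_I]

theorem exp_smul_tI_eq_conf_dir (x : ℝ) : NormedSpace.exp (x • tI) = conf (dir x) := by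
  rw [exp_smul_tI, dir_eq_exp]

theorem dir_add (x y : ℝ) : dir (x + y) = dir x * dir y := by
  simp only [dir_eq_exp, ← Complex.exp_add]; push_cast; ring_nf

theorem conj_dir (x : ℝ) : starRingEnd ℂ (dir x) = dir (-x) := by
  apply Complex.ext <;> simp

@[simp] theorem dir_zero : dir 0 = 1 := by simp [dir]

theorem mul_sinhDiv (x c : ℝ) : c * sinhDiv x c = Real.sinh (x * c) := by
  unfold sinhDiv
  split_ifs with h
  · simp [h]
  · field_simp

theorem sinhDiv_neg (x c : ℝ) : sinhDiv x (-c) = sinhDiv x c := by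
  unfold sinhDiv
  split_ifs with h h' h'
  · rfl
  · exact absurd (neg_eq_zero.1 h) h'
  · exact absurd (neg_eq_zero.2 h') h
  · rw [mul_neg, Real.sinh_neg, neg_div_neg_eq]

@[simp] theorem sinhDiv_zero_left (c : ℝ) : sinhDiv 0 c = 0 := by
  unfold sinhDiv; split_ifs <;> simp

theorem sinhDiv_pos {x : ℝ} (hx : 0 < x) (c : ℝ) : 0 < sinhDiv x c := by
  unfold sinhDiv
  split_ifs with h
  · exact hx
  · rcases lt_or_gt_of_ne h with h | h
    · exact div_pos_of_neg_of_neg (Real.sinh_neg_iff.2 (mul_neg_of_pos_of_neg hx h)) h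
    · exact div_pos (Real.sinh_pos_iff.2 (mul_pos hx h)) h

theorem sinhDiv_nonneg {x : ℝ} (hx : 0 ≤ x) (c : ℝ) : 0 ≤ sinhDiv x c := by
  rcases hx.eq_or_lt with rfl | hx
  · simp
  · exact (sinhDiv_pos hx c).le

/-- The point of angle `t` on the boundary curve of `exp D̄(0, p)`. -/
noncomputable def boundary (p t : ℝ) : ℂ := Complex.exp (p * dir t)

/-- The outward unit normal of the boundary curve of `exp D̄(0, p)` at the angle `t`. -/
noncomputable def normal (p t : ℝ) : ℂ := dir (t + p * Real.sin t)

/-- The center of the disk of radius `r` that is internally tangent to the boundary curve of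
`exp D̄(0, p)` at the angle `t`. -/
noncomputable def tangentCenter (p t r : ℝ) : ℂ := boundary p t - r * normal p t

/-- The radius of the chiral disk of the normal form. -/
noncomputable def nwRadius (p₁ p₂ t : ℝ) : ℝ := Real.exp (p₁ * Real.cos t) * sinhDiv p₂ (Real.cos t)

theorem nwRadius_nonneg (p₁ : ℝ) {p₂ : ℝ} (h : 0 ≤ p₂) (t : ℝ) : 0 ≤ nwRadius p₁ p₂ t :=
  mul_nonneg (Real.exp_pos _).le (sinhDiv_nonneg h _)

theorem boundary_eq (p t : ℝ) :
    boundary p t = Real.exp (p * Real.cos t) * dir (p * Real.sin t) := by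
  rw [boundary, dir, mul_add, Complex.exp_add, dir_eq_exp]
  push_cast
  ring_nf

theorem NW_eq_conf_add (p₁ p₂ t : ℝ) (F : M2) :
    NW p₁ p₂ t F = conf (tangentCenter (p₁ + p₂) t (nwRadius p₁ p₂ t))
      + nwRadius p₁ p₂ t • F := by
  -- With the factor `e^{p₁ cos t} dir((p₁ + p₂) sin t)` taken out, the center is `e^{p₂ c} - S (c +
  -- i sin t)`, where `c = cos t` and `S = sinhDiv p₂ c`; since `c S = sinh (p₂ c)`, the real part
  -- is `cosh (p₂ c)`.
  have key : tangentCenter (p₁ + p₂) t (nwRadius p₁ p₂ t)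
      = Real.exp (p₁ * Real.cos t) * (dir ((p₁ + p₂) * Real.sin t) *
        (Real.cosh (p₂ * Real.cos t)
          - (sinhDiv p₂ (Real.cos t) * Real.sin t : ℝ) * Complex.I)) := by
    have h1 := mul_sinhDiv p₂ (Real.cos t)
    have h2 : Real.exp ((p₁ + p₂) * Real.cos t) = Real.exp (p₁ * Real.cos t) *
        (Real.cosh (p₂ * Real.cos t) + Real.cos t * sinhDiv p₂ (Real.cos t)) := by
      rw [h1, Real.cosh_add_sinh, ← Real.exp_add]; ring_nf
    rw [tangentCenter, boundary_eq, normal, dir_add, nwRadius, h2]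
    simp only [dir]
    push_cast
    ring
  rw [key, conf_ofReal_mul, map_mul, map_sub, conf_ofReal, conf_mul_I, NW, exp_smul_tI_eq_conf_dir,
    nwRadius, smul_add, smul_smul]

theorem CD_NW (p₁ t : ℝ) {p₂ : ℝ} {F : M2} (hF : F ∈ KK) (h : 0 ≤ p₂) :
    CD (NW p₁ p₂ t F) = Metric.closedBall
      (tangentCenter (p₁ + p₂) t (nwRadius p₁ p₂ t)) (nwRadius p₁ p₂ t) := by
  rw [NW_eq_conf_add, CD_conf_add hF _ (nwRadius_nonneg p₁ h t)]

/-! ### Time-ordered exponentials -/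

theorem continuous_leftTerm {h : ℝ → M2} (hh : Continuous h) (a : ℝ) (k : ℕ) :
    Continuous (leftTerm h a k) := by
  induction k with
  | zero => exact continuous_const
  | succ k ih =>
    exact intervalIntegral.continuous_primitive
      (fun x y => (hh.mul ih).intervalIntegrable x y) a

/-- The solution and the partial sums satisfy the same Picard recursion, so the remainder does too.
Iterating this gives the factorial bound that follows. -/
theorem sub_sum_leftTerm_succ {h Y : ℝ → M2} (hh : Continuous h)
    (hY : ∀ θ, HasDerivAt Y (h θ * Y θ) θ) {a : ℝ} (ha : Y a = 1) (n : ℕ) (x : ℝ) :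
    Y x - ∑ k ∈ Finset.range (n + 1), leftTerm h a k x
      = ∫ θ in a..x, h θ * (Y θ - ∑ k ∈ Finset.range n, leftTerm h a k θ) := by
  have hYc : Continuous Y := continuous_iff_continuousAt.2 fun θ => (hY θ).continuousAt
  have h1 : ∫ θ in a..x, h θ * Y θ = Y x - 1 := by
    rw [← ha]
    exact intervalIntegral.integral_eq_sub_of_hasDerivAt (fun θ _ => hY θ)
      ((hh.mul hYc).intervalIntegrable _ _)
  have h2 : ∫ θ in a..x, h θ * ∑ k ∈ Finset.range n, leftTerm h a k θ
      = ∑ k ∈ Finset.range n, leftTerm h a (k + 1) x := by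
    simp only [Finset.mul_sum]
    rw [intervalIntegral.integral_finsetSum]
    · rfl
    · exact fun k _ => (hh.mul (continuous_leftTerm hh a k)).intervalIntegrable _ _
  have h3 : ∫ θ in a..x, (h θ * Y θ - h θ * ∑ k ∈ Finset.range n, leftTerm h a k θ)
      = (∫ θ in a..x, h θ * Y θ) - ∫ θ in a..x, h θ * ∑ k ∈ Finset.range n, leftTerm h a k θ :=
    intervalIntegral.integral_sub ((hh.mul hYc).intervalIntegrable _ _)
      ((hh.mul (continuous_finsetSum _ fun k _ => continuous_leftTerm hh a k)).intervalIntegrable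
        _ _)
  simp only [mul_sub]
  rw [h3, h1, h2, Finset.sum_range_succ']
  simp only [leftTerm]
  abel

theorem norm_sub_sum_leftTerm_le {h Y : ℝ → M2} (hh : Continuous h)
    (hY : ∀ θ, HasDerivAt Y (h θ * Y θ) θ) {a b : ℝ} (ha : Y a = 1) {M K : ℝ}
    (hM : ∀ θ ∈ Set.Icc a b, ‖h θ‖ ≤ M) (hK : ∀ θ ∈ Set.Icc a b, ‖Y θ‖ ≤ K) (n : ℕ) :
    ∀ x ∈ Set.Icc a b, ‖Y x - ∑ k ∈ Finset.range n, leftTerm h a k x‖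
      ≤ K * (M * (x - a)) ^ n / n.factorial := by
  induction n with
  | zero => intro x hx; simpa using hK x hx
  | succ n ih =>
    intro x hx
    rw [sub_sum_leftTerm_succ hh hY ha]
    have hint : ∫ θ in a..x, M * (K * (M * (θ - a)) ^ n / n.factorial)
        = K * (M * (x - a)) ^ (n + 1) / (n + 1).factorial := by
      have : ∀ θ, HasDerivAt (fun θ => K * (M * (θ - a)) ^ (n + 1) / (n + 1).factorial)
          (M * (K * (M * (θ - a)) ^ n / n.factorial)) θ := by
        intro θ
        have h1 : HasDerivAt (fun θ => M * (θ - a)) M θ := by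
          simpa using ((hasDerivAt_id θ).sub_const a).const_mul M
        refine (((h1.pow (n + 1)).const_mul K).div_const ((n + 1).factorial : ℝ)).congr_deriv ?_
        rw [Nat.factorial_succ]
        push_cast
        have : (n.factorial : ℝ) ≠ 0 := by positivity
        have : (n : ℝ) + 1 ≠ 0 := by positivity
        field_simp
      rw [intervalIntegral.integral_eq_sub_of_hasDerivAt (fun θ _ => this θ)
        (Continuous.intervalIntegrable (by fun_prop) _ _)]
      simp
    rw [← hint]
    refine intervalIntegral.norm_integral_le_of_norm_le hx.1 ?_
      (Continuous.intervalIntegrable (by fun_prop) _ _)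
    refine Filter.Eventually.of_forall fun θ hθ => ?_
    have hθ' : θ ∈ Set.Icc a b := ⟨hθ.1.le, hθ.2.trans hx.2⟩
    exact (norm_mul_le _ _).trans (mul_le_mul (hM θ hθ') (ih θ hθ') (norm_nonneg _)
      ((norm_nonneg _).trans (hM θ hθ')))

/-- The time-ordered exponential is the value of the solution of the linear equation. -/
theorem leftExp_eq_of_hasDerivAt {h Y : ℝ → M2} (hh : Continuous h)
    (hY : ∀ θ, HasDerivAt Y (h θ * Y θ) θ) {a b : ℝ} (hab : a ≤ b) (ha : Y a = 1) :
    leftExp h a b = Y b := by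
  have hYc : Continuous Y := continuous_iff_continuousAt.2 fun θ => (hY θ).continuousAt
  obtain ⟨M, hM⟩ := isCompact_Icc.exists_bound_of_continuousOn (s := Set.Icc a b) hh.continuousOn
  obtain ⟨K, hK⟩ := isCompact_Icc.exists_bound_of_continuousOn (s := Set.Icc a b) hYc.continuousOn
  set u : ℕ → ℝ := fun n => K * (M * (b - a)) ^ n / n.factorial with hu
  have hbound : ∀ n, ‖Y b - ∑ k ∈ Finset.range n, leftTerm h a k b‖ ≤ u n := fun n =>
    norm_sub_sum_leftTerm_le hh hY ha hM hK n b ⟨hab, le_rfl⟩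
  have hus : Summable u := by
    simpa only [hu, mul_div_assoc] using (Real.summable_pow_div_factorial (M * (b - a))).mul_left K
  -- A term is the difference of two consecutive remainders, hence summable in norm; this makes the
  -- `tsum` the limit of the partial sums.
  have hterm : ∀ n, ‖leftTerm h a n b‖ ≤ u n + u (n + 1) := by
    intro n
    have : leftTerm h a n b = (Y b - ∑ k ∈ Finset.range n, leftTerm h a k b)
        - (Y b - ∑ k ∈ Finset.range (n + 1), leftTerm h a k b) := by
      rw [Finset.sum_range_succ]; abel
    rw [this]
    exact (norm_sub_le _ _).trans (add_le_add (hbound n) (hbound (n + 1)))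
  have hsum : Summable fun n => leftTerm h a n b :=
    Summable.of_norm_bounded (hus.add ((summable_nat_add_iff 1).2 hus)) hterm
  refine (hsum.hasSum_iff_tendsto_nat.2 ?_).tsum_eq
  rw [tendsto_iff_norm_sub_tendsto_zero]
  refine squeeze_zero (fun _ => norm_nonneg _) (fun n => ?_) hus.tendsto_atTop_zero
  rw [norm_sub_rev]
  exact hbound n

theorem hasDerivAt_conf_dir (w θ : ℝ) :
    HasDerivAt (fun θ : ℝ => conf (dir (w * θ))) (conf (w * Complex.I) * conf (dir (w * θ))) θ := by
  have h := hasDerivAt_exp_smul_const' (𝕂 := ℝ) (w • tI) θ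
  simp only [smul_smul, exp_smul_tI_eq_conf_dir] at h
  rw [conf_mul_I]
  simpa only [mul_comm w] using h

theorem continuous_conf_dir : Continuous fun θ : ℝ => conf (dir θ) := by
  refine continuous_conf.comp ?_
  unfold dir
  fun_prop

/-- The time-ordered exponential of a density that rotates with constant speed. -/
theorem leftExp_rotating (B : M2) (w : ℝ) {a b : ℝ} (hab : a ≤ b) :
    leftExp (fun θ => conf (dir (w * θ)) * B * conf (dir (-(w * θ)))) a b
      = conf (dir (w * b)) * NormedSpace.exp ((b - a) • (B - conf (w * Complex.I)))
        * conf (dir (-(w * a))) := by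
  have hinv : ∀ x : ℝ, conf (dir (-x)) * conf (dir x) = 1 := fun x => by
    rw [← map_mul, ← dir_add]; simp
  have hinv' : ∀ x : ℝ, conf (dir x) * conf (dir (-x)) = 1 := fun x => by
    rw [← map_mul, ← dir_add]; simp
  -- In the frame turning with the density the equation has the constant coefficient `B - w Ĩ`.
  refine leftExp_eq_of_hasDerivAt (Y := fun θ => conf (dir (w * θ))
    * NormedSpace.exp ((θ - a) • (B - conf (w * Complex.I))) * conf (dir (-(w * a)))) ?_ ?_ hab ?_
  · refine ((continuous_conf_dir.comp (continuous_const.mul continuous_id)).mul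
      continuous_const).mul (continuous_conf_dir.comp ?_)
    fun_prop
  · intro θ
    have h1 := hasDerivAt_conf_dir w θ
    have h2 := (hasDerivAt_exp_smul_const' (𝕂 := ℝ) (B - conf (w * Complex.I)) (θ - a)).scomp θ
      ((hasDerivAt_id θ).sub_const a)
    refine ((h1.mul h2).mul_const (conf (dir (-(w * a))))).congr_deriv ?_
    have hcomm : conf (w * Complex.I) * conf (dir (w * θ))
        = conf (dir (w * θ)) * conf (w * Complex.I) := by
      rw [← map_mul, ← map_mul, mul_comm]
    have : conf (dir (w * θ)) * B * conf (dir (-(w * θ))) * (conf (dir (w * θ))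
        * NormedSpace.exp ((θ - a) • (B - conf (w * Complex.I))) * conf (dir (-(w * a))))
        = conf (dir (w * θ)) * B * (conf (dir (-(w * θ))) * conf (dir (w * θ)))
        * NormedSpace.exp ((θ - a) • (B - conf (w * Complex.I))) * conf (dir (-(w * a))) := by
      noncomm_ring
    rw [this, hinv]
    simp only [one_smul, Function.comp_apply, id, hcomm]
    noncomm_ring
  · simp [hinv']

/-- The exponential of a matrix whose square is scalar. -/
theorem exp_smul_of_mul_self {N : M2} {c : ℝ} (hN : N * N = (c ^ 2) • (1 : M2)) (x : ℝ) :
    NormedSpace.exp (x • N) = Real.cosh (x * c) • (1 : M2) + sinhDiv x c • N := by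
  -- For `x ≥ 0` both sides solve `Y' = N Y` from `1`, so both equal the same time-ordered
  -- exponential. Negative `x` is reached by changing the signs of `x` and `N` together.
  have hx : ∀ x, 0 ≤ x → ∀ N : M2, N * N = (c ^ 2) • (1 : M2) →
      NormedSpace.exp (x • N) = Real.cosh (x * c) • (1 : M2) + sinhDiv x c • N := by
    intro x hx N hN
    have h1 : leftExp (fun _ => N) 0 x = NormedSpace.exp (x • N) :=
      leftExp_eq_of_hasDerivAt (Y := fun x => NormedSpace.exp (x • N)) continuous_const
        (fun θ => hasDerivAt_exp_smul_const' (𝕂 := ℝ) N θ) hx (by simp)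
    have h2 : leftExp (fun _ => N) 0 x = Real.cosh (x * c) • (1 : M2) + sinhDiv x c • N := by
      refine leftExp_eq_of_hasDerivAt
        (Y := fun x => Real.cosh (x * c) • (1 : M2) + sinhDiv x c • N) continuous_const
        (fun θ => ?_) hx (by simp)
      have hl : HasDerivAt (fun x : ℝ => x * c) c θ := by
        simpa using (hasDerivAt_id θ).mul_const c
      have hc : HasDerivAt (fun x => Real.cosh (x * c)) (c ^ 2 * sinhDiv θ c) θ := by
        refine hl.cosh.congr_deriv ?_
        rw [← mul_sinhDiv]; ring
      have hs : HasDerivAt (fun x => sinhDiv x c) (Real.cosh (θ * c)) θ := by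
        by_cases h0 : c = 0
        · subst h0
          simpa [sinhDiv] using hasDerivAt_id' θ
        · simp only [sinhDiv, h0, if_false]
          refine (hl.sinh.div_const c).congr_deriv ?_
          field_simp
      refine ((hc.smul_const (1 : M2)).add (hs.smul_const N)).congr_deriv ?_
      rw [mul_add, mul_smul_comm, mul_smul_comm, hN, mul_one, smul_smul, mul_comm (c ^ 2)]
      abel
    rw [← h1, h2]
  rcases le_total 0 x with h | h
  · exact hx x h N hN
  · have := hx (-x) (neg_nonneg.2 h) (-N) (by rw [neg_mul_neg, hN])
    rw [smul_neg, neg_smul, neg_neg] at this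
    rw [this, neg_mul, Real.cosh_neg]
    congr 1
    unfold sinhDiv
    split_ifs
    · simp
    · rw [neg_mul, Real.sinh_neg, neg_div, smul_neg, neg_smul, neg_neg]

theorem KK.conj_rotation {F : M2} (hF : F ∈ KK) (x : ℝ) :
    conf (dir x) * F * conf (dir (-x)) = conf (dir (2 * x)) * F := by
  rw [mul_assoc, KK.mul_conf hF, conj_dir, neg_neg, ← mul_assoc, ← map_mul, ← dir_add, two_mul]

/-- `F` anticommutes with `Ĩ`, so the cross terms cancel and `1 - sin² t` remains. -/
theorem KK.sub_mul_self {F : M2} (hF : F ∈ KK) (t : ℝ) :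
    (F - Real.sin t • tI) * (F - Real.sin t • tI) = (Real.cos t ^ 2) • (1 : M2) := by
  have h1 : F * tI = -(tI * F) := by
    have h := KK.mul_conf hF Complex.I
    have hI : conf Complex.I = tI := by simpa using conf_mul_I 1
    rwa [Complex.conj_I, map_neg, hI, neg_mul] at h
  have h2 : Real.cos t ^ 2 = 1 - Real.sin t ^ 2 := by rw [Real.cos_sq']
  rw [sub_mul, mul_sub, mul_sub, KK.mul_self hF, mul_smul_comm, h1, smul_mul_assoc, smul_mul_assoc,
    mul_smul_comm, tI_mul_tI, h2, smul_smul]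
  module

theorem conf_dir (t : ℝ) : conf (dir t) = Real.cos t • (1 : M2) + Real.sin t • tI := by
  rw [dir, map_add, conf_ofReal, conf_mul_I]

theorem exp_smul_one (x : ℝ) : NormedSpace.exp (x • (1 : M2)) = Real.exp x • (1 : M2) := by
  rw [← conf_ofReal, exp_conf, ← Complex.ofReal_exp, conf_ofReal]

theorem leftExp_ellipticDensity (t : ℝ) {p : ℝ} (hp : 0 ≤ p) :
    leftExp (ellipticDensity t) 0 p = NormedSpace.exp (p • NormedSpace.exp (t • tI)) :=
  leftExp_eq_of_hasDerivAt (Y := fun x => NormedSpace.exp (x • NormedSpace.exp (t • tI)))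
    continuous_const (fun θ => hasDerivAt_exp_smul_const' (𝕂 := ℝ) _ θ) hp (by simp)

theorem leftExp_ellipticDensity_eq_conf (t : ℝ) {p : ℝ} (hp : 0 ≤ p) :
    leftExp (ellipticDensity t) 0 p
      = Real.exp (p * Real.cos t) • conf (dir (p * Real.sin t)) := by
  rw [leftExp_ellipticDensity t hp, exp_smul_tI_eq_conf_dir, ← conf_ofReal_mul, exp_conf, ← boundary,
    boundary_eq, conf_ofReal_mul]

theorem developmentDensity_eq (t s : ℝ) {F : M2} (hF : F ∈ KK) :
    developmentDensity t s F = fun θ => conf (dir (Real.sin t * θ))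
      * (conf (dir (s * Real.sin t)) * F) * conf (dir (-(Real.sin t * θ))) := by
  funext θ
  rw [KK.conj_rotation (KK.conf_mul_mem hF (norm_dir _)), developmentDensity, exp_smul_tI_eq_conf_dir,
    ← mul_assoc, ← map_mul, ← dir_add]
  ring_nf

theorem leftExp_developmentDensity (t s : ℝ) {F : M2} (hF : F ∈ KK) {p : ℝ} (hp : 0 ≤ p) :
    leftExp (developmentDensity t s F) 0 p = conf (dir (p * Real.sin t)) *
      (Real.cosh (p * Real.cos t) • (1 : M2) + sinhDiv p (Real.cos t) •
        (conf (dir (s * Real.sin t)) * F - Real.sin t • tI)) := by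
  rw [developmentDensity_eq t s hF, leftExp_rotating _ _ hp, sub_zero, conf_mul_I,
    exp_smul_of_mul_self (KK.sub_mul_self (KK.conf_mul_mem hF (norm_dir _)) t)]
  simp [mul_comm]

theorem conf_dir_mul_tI (x : ℝ) : conf (dir x) * tI = tI * conf (dir x) := by
  have hI : conf Complex.I = tI := by simpa using conf_mul_I 1
  rw [← hI, ← map_mul, ← map_mul, mul_comm]

/-- The two factors contribute rotations by `p₁ sin t` and `p₂ sin t`; the shift `-p₁ - p₂` is the
one that cancels both in front of `F`. -/
theorem NW_eq_elliptic_mul_development (t : ℝ) {F : M2} (hF : F ∈ KK) {p₁ p₂ : ℝ} (h₁ : 0 ≤ p₁)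
    (h₂ : 0 ≤ p₂) : NW p₁ p₂ t F = leftExp (ellipticDensity t) 0 p₁ *
      leftExp (developmentDensity t (-p₁ - p₂) F) 0 p₂ := by
  rw [leftExp_ellipticDensity_eq_conf t h₁, leftExp_developmentDensity t _ hF h₂, NW,
    exp_smul_tI_eq_conf_dir, smul_mul_assoc, ← mul_assoc, ← map_mul, ← dir_add, ← add_mul]
  have h : conf (dir ((p₁ + p₂) * Real.sin t)) * (conf (dir ((-p₁ - p₂) * Real.sin t)) * F)
      = F := by
    rw [← mul_assoc, ← map_mul, ← dir_add, ← add_mul]; simp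
  simp only [mul_add, mul_sub, smul_sub, mul_smul_comm, h, smul_smul]
  module

/-- Here the elliptic rotation stands to the right of `F` and changes sign when moved across it, so
the phases cancel as `p₂ + (p₁ - p₂) - p₁ = 0`. -/
theorem NW_eq_development_mul_elliptic (t : ℝ) {F : M2} (hF : F ∈ KK) {p₁ p₂ : ℝ} (h₁ : 0 ≤ p₁)
    (h₂ : 0 ≤ p₂) : NW p₁ p₂ t F = leftExp (developmentDensity t (p₁ - p₂) F) 0 p₂ *
      leftExp (ellipticDensity t) 0 p₁ := by
  rw [leftExp_ellipticDensity_eq_conf t h₁, leftExp_developmentDensity t _ hF h₂, NW,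
    exp_smul_tI_eq_conf_dir, mul_smul_comm]
  have h : conf (dir (p₂ * Real.sin t)) * (conf (dir ((p₁ - p₂) * Real.sin t)) * F)
      * conf (dir (p₁ * Real.sin t)) = F := by
    rw [mul_assoc, mul_assoc, KK.mul_conf hF, conj_dir, ← mul_assoc (conf _), ← map_mul, ← dir_add,
      ← mul_assoc, ← map_mul, ← dir_add]
    ring_nf
    simp
  have h' : conf (dir (p₂ * Real.sin t)) * conf (dir (p₁ * Real.sin t))
      = conf (dir ((p₁ + p₂) * Real.sin t)) := by
    rw [← map_mul, ← dir_add]; ring_nf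
  have h'' : conf (dir (p₂ * Real.sin t)) * tI * conf (dir (p₁ * Real.sin t))
      = conf (dir ((p₁ + p₂) * Real.sin t)) * tI := by
    rw [mul_assoc, ← conf_dir_mul_tI, ← mul_assoc, h']
  generalize conf (dir ((p₁ + p₂) * Real.sin t)) = D at *
  generalize conf (dir ((p₁ - p₂) * Real.sin t)) = E at *
  simp only [mul_add, add_mul, sub_mul, mul_sub, smul_sub, mul_smul_comm, smul_mul_assoc, h, h',
    h'', smul_smul, mul_one]
  module

theorem uniformDensity_eq (p₁ p₂ t : ℝ) {F : M2} (hF : F ∈ KK) :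
    uniformDensity p₁ p₂ t F = fun θ => conf (dir ((p₁ + p₂) * Real.sin t * θ))
      * (p₁ • conf (dir t) + p₂ • F) * conf (dir (-((p₁ + p₂) * Real.sin t * θ))) := by
  funext θ
  have h : ∀ x, conf (dir x) * conf (dir t) * conf (dir (-x)) = conf (dir t) := fun x => by
    rw [← map_mul, ← map_mul, ← dir_add, ← dir_add]; ring_nf
  rw [mul_add, add_mul, mul_smul_comm, smul_mul_assoc, h, mul_smul_comm, smul_mul_assoc,
    KK.conj_rotation hF, uniformDensity, exp_smul_tI_eq_conf_dir, exp_smul_tI_eq_conf_dir]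
  ring_nf

theorem NW_eq_leftExp_uniformDensity (p₁ p₂ t : ℝ) {F : M2} (hF : F ∈ KK) :
    NW p₁ p₂ t F = leftExp (uniformDensity p₁ p₂ t F) (-1 / 2) (1 / 2) := by
  rw [uniformDensity_eq p₁ p₂ t hF, leftExp_rotating _ _ (by norm_num)]
  set x := (p₁ + p₂) * Real.sin t * (1 / 2) with hx
  have hx1 : -((p₁ + p₂) * Real.sin t * (-1 / 2)) = x := by rw [hx]; ring
  have hx2 : (p₁ + p₂) * Real.sin t = x + x := by rw [hx]; ring
  -- In the rotating frame the `Ĩ`-coefficient is `p₁ sin t - (p₁ + p₂) sin t = -p₂ sin t`. What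
  -- remains is a scalar plus a multiple of `F - sin t Ĩ`, and these commute.
  have hN : ((1 / 2 : ℝ) - -1 / 2) • (p₁ • conf (dir t) + p₂ • F
      - conf (((p₁ + p₂) * Real.sin t : ℝ) * Complex.I))
      = (p₁ * Real.cos t) • (1 : M2) + p₂ • (F - Real.sin t • tI) := by
    rw [conf_mul_I, conf_dir]
    module
  have hc : Commute ((p₁ * Real.cos t) • (1 : M2)) (p₂ • (F - Real.sin t • tI)) :=
    (Commute.one_left _).smul_left _
  rw [hN, Matrix.exp_add_of_commute _ _ hc, exp_smul_one,
    exp_smul_of_mul_self (KK.sub_mul_self hF t), hx1, NW, exp_smul_tI_eq_conf_dir, hx2]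
  have h1 : conf (dir x) * conf (dir x) = conf (dir (x + x)) := by rw [← map_mul, ← dir_add]
  have h2 : conf (dir x) * tI * conf (dir x) = conf (dir (x + x)) * tI := by
    rw [mul_assoc, ← conf_dir_mul_tI, ← mul_assoc, h1]
  have h3 : conf (dir x) * F * conf (dir x) = F := by
    rw [mul_assoc, KK.mul_conf hF, conj_dir, ← mul_assoc, ← map_mul, ← dir_add]; simp
  simp only [mul_add, add_mul, sub_mul, mul_sub, smul_sub, mul_smul_comm, smul_mul_assoc, h1,
    h2, h3, smul_smul, mul_one, one_mul, smul_add]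
  module

/-! ### Total variations and developments -/

theorem norm_conf_dir_mul (x : ℝ) (B : M2) : ‖conf (dir x) * B‖ = ‖B‖ := by
  have hle : ∀ y, ‖conf (dir y)‖ ≤ 1 := fun y => by
    refine CStarRing.norm_of_mem_unitary (U := conf (dir y)) ?_ |>.le
    have hs : star (conf (dir y)) = conf (dir (-y)) := by
      ext i j; fin_cases i <;> fin_cases j <;> simp [conf_apply, Matrix.star_apply]
    rw [Unitary.mem_iff, hs]
    constructor <;> rw [← map_mul, ← dir_add] <;> simp
  have hmul : ∀ y B, ‖conf (dir y) * B‖ ≤ ‖B‖ := fun y B =>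
    (norm_mul_le _ _).trans (mul_le_of_le_one_left (norm_nonneg _) (hle y))
  refine le_antisymm (hmul x B) ?_
  have h := hmul (-x) (conf (dir x) * B)
  rwa [← mul_assoc, ← map_mul, ← dir_add, neg_add_cancel, dir_zero, map_one, one_mul] at h

theorem KK.norm_eq_one {F : M2} (hF : F ∈ KK) : ‖F‖ = 1 := by
  refine CStarRing.norm_of_mem_unitary ?_
  have hs : star F = F := by
    obtain ⟨x, y, h, rfl⟩ := mem_KK_iff.1 hF
    ext i j; fin_cases i <;> fin_cases j <;> simp [Matrix.star_apply]
  rw [Unitary.mem_iff, hs, KK.mul_self hF]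
  simp

theorem KK.norm_smul_one_add_smul {F : M2} (hF : F ∈ KK) {a b : ℝ} (ha : 0 ≤ a) (hb : 0 ≤ b) :
    ‖a • (1 : M2) + b • F‖ = a + b := by
  refine le_antisymm ?_ ?_
  · refine (norm_add_le _ _).trans ?_
    rw [norm_smul, norm_smul, KK.norm_eq_one hF, CStarRing.norm_one, Real.norm_of_nonneg ha,
      Real.norm_of_nonneg hb, mul_one, mul_one]
  · have h : (a • (1 : M2) + b • F) * (1 + F) = (a + b) • (1 + F) := by
      simp only [add_mul, mul_add, smul_mul_assoc, KK.mul_self hF, one_mul, mul_one]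
      module
    have h1 := norm_mul_le (a • (1 : M2) + b • F) (1 + F)
    rw [h, norm_smul, Real.norm_of_nonneg (add_nonneg ha hb)] at h1
    exact le_of_mul_le_mul_right h1 (norm_pos_iff.2 (KK.one_add_ne_zero hF))

theorem norm_uniformDensity {p₁ p₂ : ℝ} (h₁ : 0 ≤ p₁) (h₂ : 0 ≤ p₂) (t : ℝ) {F : M2}
    (hF : F ∈ KK) (θ : ℝ) : ‖uniformDensity p₁ p₂ t F θ‖ = p₁ + p₂ := by
  rw [uniformDensity, exp_smul_tI_eq_conf_dir, exp_smul_tI_eq_conf_dir, ← norm_conf_dir_mul (-t), mul_add,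
    mul_smul_comm, ← map_mul, ← dir_add, neg_add_cancel, dir_zero, map_one, mul_smul_comm,
    ← mul_assoc, ← map_mul, ← dir_add]
  exact KK.norm_smul_one_add_smul (KK.conf_mul_mem hF (norm_dir _)) h₁ h₂

theorem variation_uniformDensity {p₁ p₂ : ℝ} (h₁ : 0 ≤ p₁) (h₂ : 0 ≤ p₂) (t : ℝ) {F : M2}
    (hF : F ∈ KK) : variation (uniformDensity p₁ p₂ t F) (-1 / 2) (1 / 2) = p₁ + p₂ := by
  simp only [variation, norm_uniformDensity h₁ h₂ t hF]
  norm_num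

theorem variation_ellipticDensity (t p : ℝ) : variation (ellipticDensity t) 0 p = p := by
  have h : ‖conf (dir t)‖ = 1 := by
    rw [← mul_one (conf (dir t)), norm_conf_dir_mul, CStarRing.norm_one]
  simp [variation, ellipticDensity, exp_smul_tI_eq_conf_dir, h]

theorem variation_developmentDensity (t s p : ℝ) {F : M2} (hF : F ∈ KK) :
    variation (developmentDensity t s F) 0 p = p := by
  simp [variation, developmentDensity, exp_smul_tI_eq_conf_dir, norm_conf_dir_mul, KK.norm_eq_one hF]

theorem isDevelopment_developmentDensity (t s : ℝ) {F : M2} (hF : F ∈ KK) :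
    IsDevelopment (Real.sin t) (developmentDensity t s F) := by
  obtain ⟨β, -, -, hβ⟩ := hF
  have hK : tK ∈ KK := mem_KK_iff.2 ⟨0, 1, by norm_num, by simp [tK]⟩
  have hFK : F = conf (dir β) * tK := by
    rw [hβ]
    ext i j; fin_cases i <;> fin_cases j <;> simp [conf_apply, tJ, tK]
  have hstd : ∀ θ, standardDevelopment (Real.sin t) θ
      = conf (dir (2 * (θ * Real.sin t))) * tK := fun θ => by
    ext i j; fin_cases i <;> fin_cases j <;> simp [standardDevelopment, conf_apply, tK]
  have htr : ∀ x, (conf (dir x)).transpose = conf (dir (-x)) := fun x => by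
    ext i j; fin_cases i <;> fin_cases j <;> simp [conf_apply]
  -- Conjugating a reflection by a rotation doubles the angle, so half of the constant phase is
  -- used.
  refine ⟨conf (dir ((s * Real.sin t + β) / 2)), ?_, fun θ => ?_⟩
  · rw [Matrix.mem_specialOrthogonalGroup_iff]
    constructor
    · rw [Matrix.mem_orthogonalGroup_iff]
      rw [htr, ← map_mul, ← dir_add]; simp
    · simp [conf_apply, Matrix.det_fin_two_of, ← sq]
  · rw [hstd, htr, ← mul_assoc, ← map_mul, ← dir_add, mul_assoc, KK.mul_conf hK, conj_dir,
      developmentDensity, exp_smul_tI_eq_conf_dir, hFK, ← mul_assoc, ← mul_assoc, ← map_mul, ← map_mul,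
      ← dir_add, ← dir_add]
    ring_nf

/-! ### The trigonometric inequality -/

theorem sinh_lt_mul_cosh {x : ℝ} (hx : 0 < x) : Real.sinh x < x * Real.cosh x := by
  have hd : ∀ y, HasDerivAt (fun y => y * Real.cosh y - Real.sinh y) (y * Real.sinh y) y := by
    intro y
    refine (((hasDerivAt_id' y).mul (Real.hasDerivAt_cosh y)).sub
      (Real.hasDerivAt_sinh y)).congr_deriv ?_
    ring
  have hmono : StrictMonoOn (fun y => y * Real.cosh y - Real.sinh y) (Set.Ici 0) := by
    refine strictMonoOn_of_deriv_pos (convex_Ici 0)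
      (fun y _ => (hd y).continuousAt.continuousWithinAt) fun y hy => ?_
    rw [interior_Ici] at hy
    rw [(hd y).deriv]
    exact mul_pos hy (Real.sinh_pos_iff.2 hy)
  have := hmono Set.self_mem_Ici hx.le hx
  simp at this
  linarith

theorem continuous_sinhDiv (p : ℝ) : Continuous (sinhDiv p) := by
  have hd : ∀ c, HasDerivAt (fun c => Real.sinh (p * c)) (Real.cosh (p * c) * p) c := fun c => by
    simpa using ((hasDerivAt_id' c).const_mul p).sinh
  have h : sinhDiv p = dslope (fun c => Real.sinh (p * c)) 0 := by
    funext c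
    by_cases hc : c = 0
    · rw [hc, dslope_same, (hd 0).deriv]; simp [sinhDiv]
    · rw [dslope_of_ne _ hc, slope_def_field]; simp [sinhDiv, hc]
  rw [h, continuous_iff_continuousAt]
  intro c
  by_cases hc : c = 0
  · rw [hc, continuousAt_dslope_same]; exact (hd 0).differentiableAt
  · rw [continuousAt_dslope_of_ne hc]; exact (hd c).continuousAt

/-- The solution of `f'' + p² f = 0` in the variable `σ` that is tangent to the function
`sin t ↦ cosh (p cos t)` at `sin t`. -/
noncomputable def tangentFun (p t σ : ℝ) : ℝ :=
  Real.cosh (p * Real.cos t) * Real.cos (p * (σ - Real.sin t))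
    - Real.sin t * sinhDiv p (Real.cos t) * Real.sin (p * (σ - Real.sin t))

theorem continuous_tangentFun (p σ : ℝ) : Continuous fun t => tangentFun p t σ := by
  have := continuous_sinhDiv p
  unfold tangentFun
  fun_prop

/-- An envelope computation: the derivative in `t` again solves `f'' + p² f = 0` in `σ`, and
tangency makes it vanish at `σ = sin t`, so it is a multiple of `sin (p (σ - sin t))`. -/
theorem hasDerivAt_tangentFun (p σ : ℝ) {t : ℝ} (ht : 0 < Real.cos t) :
    HasDerivAt (fun t => tangentFun p t σ)
      ((p * Real.cos t * Real.cosh (p * Real.cos t) - Real.sinh (p * Real.cos t))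
        / Real.cos t ^ 2 * Real.sin (p * (σ - Real.sin t))) t := by
  have h1 : HasDerivAt (fun t => p * Real.cos t) (p * -Real.sin t) t :=
    (Real.hasDerivAt_cos t).const_mul p
  have h2 : HasDerivAt (fun t => p * (σ - Real.sin t)) (p * -Real.cos t) t :=
    ((Real.hasDerivAt_sin t).const_sub σ).const_mul p
  have h3 := ((h1.cosh).mul h2.cos).sub (((Real.hasDerivAt_sin t).mul
    (h1.sinh.div (Real.hasDerivAt_cos t) ht.ne')).mul h2.sin)
  refine (h3.congr_deriv ?_).congr_of_eventuallyEq ?_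
  · have hs : Real.sin t ^ 2 = 1 - Real.cos t ^ 2 := Real.sin_sq t
    simp only [Pi.mul_apply, Pi.div_apply]
    field_simp
    ring_nf
    simp only [hs]
    ring
  · filter_upwards [Real.continuous_cos.continuousAt.eventually_ne ht.ne'] with x hx
    simp [tangentFun, sinhDiv, hx]

theorem deriv_tangentFun_coeff_pos {p c : ℝ} (hp : 0 < p) (hc : 0 < c) :
    0 < (p * c * Real.cosh (p * c) - Real.sinh (p * c)) / c ^ 2 :=
  div_pos (sub_pos.2 (sinh_lt_mul_cosh (mul_pos hp hc))) (by positivity)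

theorem tangentFun_self (p t : ℝ) : tangentFun p t (Real.sin t) = Real.cosh (p * Real.cos t) := by
  simp [tangentFun]

/-- Slide the point of tangency from `t` to `t'`: the phase stays strictly between `0` and `±π`, so
the value at `sin t'` strictly increases until it becomes `cosh (p cos t')`. At the endpoints, where
the cosine may vanish, only continuity is used. -/
theorem tangentFun_lt_of_mem_Icc {p t t' : ℝ} (hp : 0 < p)
    (ht : t ∈ Set.Icc (-(Real.pi / 2)) (Real.pi / 2))
    (ht' : t' ∈ Set.Icc (-(Real.pi / 2)) (Real.pi / 2)) (hne : t ≠ t')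
    (h : p * |Real.sin t' - Real.sin t| ≤ Real.pi) :
    tangentFun p t (Real.sin t') < Real.cosh (p * Real.cos t') := by
  rw [← tangentFun_self]
  rcases lt_or_gt_of_ne hne with hlt | hlt
  · refine strictMonoOn_of_deriv_pos (f := fun x => tangentFun p x (Real.sin t'))
      (convex_Icc t t') (continuous_tangentFun p _).continuousOn (fun x hx => ?_)
      (Set.left_mem_Icc.2 hlt.le) (Set.right_mem_Icc.2 hlt.le) hlt
    rw [interior_Icc] at hx
    have hc : 0 < Real.cos x := Real.cos_pos_of_mem_Ioo
      ⟨lt_of_le_of_lt ht.1 hx.1, lt_of_lt_of_le hx.2 ht'.2⟩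
    have h1 : Real.sin t < Real.sin x :=
      Real.strictMonoOn_sin ht ⟨ht.1.trans hx.1.le, hx.2.le.trans ht'.2⟩ hx.1
    have h2 : Real.sin x < Real.sin t' :=
      Real.strictMonoOn_sin ⟨ht.1.trans hx.1.le, hx.2.le.trans ht'.2⟩ ht' hx.2
    rw [(hasDerivAt_tangentFun p _ hc).deriv]
    rw [abs_of_pos (by linarith)] at h
    exact mul_pos (deriv_tangentFun_coeff_pos hp hc)
      (Real.sin_pos_of_pos_of_lt_pi (mul_pos hp (by linarith)) (by nlinarith))
  · refine strictAntiOn_of_deriv_neg (f := fun x => tangentFun p x (Real.sin t'))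
      (convex_Icc t' t) (continuous_tangentFun p _).continuousOn (fun x hx => ?_)
      (Set.left_mem_Icc.2 hlt.le) (Set.right_mem_Icc.2 hlt.le) hlt
    rw [interior_Icc] at hx
    have hc : 0 < Real.cos x := Real.cos_pos_of_mem_Ioo
      ⟨lt_of_le_of_lt ht'.1 hx.1, lt_of_lt_of_le hx.2 ht.2⟩
    have h1 : Real.sin t' < Real.sin x :=
      Real.strictMonoOn_sin ht' ⟨ht'.1.trans hx.1.le, hx.2.le.trans ht.2⟩ hx.1
    have h2 : Real.sin x < Real.sin t :=
      Real.strictMonoOn_sin ⟨ht'.1.trans hx.1.le, hx.2.le.trans ht.2⟩ ht hx.2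
    rw [(hasDerivAt_tangentFun p _ hc).deriv]
    rw [abs_of_neg (by linarith)] at h
    exact mul_neg_of_pos_of_neg (deriv_tangentFun_coeff_pos hp hc)
      (Real.sin_neg_of_neg_of_neg_pi_lt (mul_neg_of_pos_of_neg hp (by linarith)) (by nlinarith))

/-- The cosine enters evenly, so only `sin t` matters and angles can be brought into `[-π/2, π/2]`
by `arcsin`. -/
theorem tangentFun_congr {p t u σ : ℝ} (hs : Real.sin u = Real.sin t)
    (hc : Real.cos u = |Real.cos t|) : tangentFun p u σ = tangentFun p t σ := by
  unfold tangentFun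
  rw [hs, hc]
  rcases abs_choice (Real.cos t) with h | h <;> rw [h]
  rw [sinhDiv_neg, mul_neg, Real.cosh_neg]

theorem tangentFun_neg (p t σ : ℝ) : tangentFun p (-t) (-σ) = tangentFun p t σ := by
  unfold tangentFun
  rw [Real.sin_neg, Real.cos_neg]
  have : p * (-σ - -Real.sin t) = -(p * (σ - Real.sin t)) := by ring
  rw [this, Real.cos_neg, Real.sin_neg]
  ring

theorem tangentFun_lt_of_le {p t t' : ℝ} (hp : 0 < p) (hne : Real.sin t ≠ Real.sin t')
    (h : p * |Real.sin t' - Real.sin t| ≤ Real.pi) :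
    tangentFun p t (Real.sin t') < Real.cosh (p * Real.cos t') := by
  have hs : ∀ x, Real.sin (Real.arcsin (Real.sin x)) = Real.sin x := fun x =>
    Real.sin_arcsin (Real.neg_one_le_sin x) (Real.sin_le_one x)
  have hc : ∀ x, Real.cos (Real.arcsin (Real.sin x)) = |Real.cos x| := fun x => by
    rw [Real.cos_arcsin, ← Real.cos_sq', Real.sqrt_sq_eq_abs]
  have key := tangentFun_lt_of_mem_Icc (t := Real.arcsin (Real.sin t))
    (t' := Real.arcsin (Real.sin t')) hp (Real.arcsin_mem_Icc _) (Real.arcsin_mem_Icc _)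
    (fun he => hne (by rw [← hs t, he, hs t'])) (by rwa [hs, hs])
  rw [hs, hc, tangentFun_congr (hs t) (hc t)] at key
  refine key.trans_eq ?_
  rcases abs_choice (Real.cos t') with h | h <;> rw [h]
  rw [mul_neg, Real.cosh_neg]

theorem tangentFun_lt_of_gt {p t t' : ℝ} (hp : 0 < p) (hpi : p < Real.pi)
    (hlt : Real.sin t' < Real.sin t) (h : Real.pi < p * (Real.sin t - Real.sin t')) :
    tangentFun p t (Real.sin t') < Real.cosh (p * Real.cos t') := by
  have hs1 := Real.sin_le_one t
  have hs1' := Real.neg_one_le_sin t'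
  have hs0 : 0 < Real.sin t := by nlinarith
  have hs0' : Real.sin t' < 0 := by nlinarith
  have hS := sinhDiv_pos hp (Real.cos t)
  have hC : 0 < Real.cosh (p * Real.cos t) := Real.cosh_pos _
  -- Beyond phase `π` the sliding argument loses its sign. A shift by the period `2π` puts the phase
  -- in `(0, π)`, because `p < π`, and makes the sine term of `tangentFun` a negative contribution.
  set ω := p * (Real.sin t' - Real.sin t) + 2 * Real.pi with hω
  have hωpi : ω < Real.pi := by rw [hω]; nlinarith
  have hω0 : 0 < ω := by rw [hω]; nlinarith
  have hsω : 0 < Real.sin ω := Real.sin_pos_of_pos_of_lt_pi hω0 hωpi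
  have hT : tangentFun p t (Real.sin t') = Real.cosh (p * Real.cos t) * Real.cos ω
      - Real.sin t * sinhDiv p (Real.cos t) * Real.sin ω := by
    rw [tangentFun, hω, Real.cos_add_two_pi, Real.sin_add_two_pi]
  have hsub : 0 < Real.sin t * sinhDiv p (Real.cos t) * Real.sin ω := by positivity
  rcases le_or_gt (-Real.sin t') (Real.sin t) with hle | hgt
  · have hcosh : Real.cosh (p * Real.cos t) ≤ Real.cosh (p * Real.cos t') := by
      rw [Real.cosh_le_cosh, abs_mul, abs_mul]
      refine mul_le_mul_of_nonneg_left (sq_le_sq.1 ?_) (abs_nonneg p)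
      rw [Real.cos_sq', Real.cos_sq']
      nlinarith
    have : Real.cosh (p * Real.cos t) * Real.cos ω ≤ Real.cosh (p * Real.cos t) :=
      mul_le_of_le_one_right hC.le (Real.cos_le_one ω)
    rw [hT]
    linarith
  · rcases le_or_gt ω (Real.pi / 2) with hω2 | hω2
    · set ω' := p * (-Real.sin t' - Real.sin t) with hω'
      have hω'0 : 0 < ω' := mul_pos hp (by linarith)
      have hωω' : ω' < ω := by rw [hω, hω']; nlinarith
      have hcos : Real.cos ω ≤ Real.cos ω' :=
        Real.cos_le_cos_of_nonneg_of_le_pi hω'0.le (by linarith) hωω'.le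
      have hsin : Real.sin ω' ≤ Real.sin ω :=
        Real.sin_le_sin_of_le_of_le_pi_div_two (by linarith) hω2 hωω'.le
      have hrefl := tangentFun_lt_of_le (t := t) (t' := -t') hp (by rw [Real.sin_neg]; exact hgt.ne)
        (by rw [Real.sin_neg, abs_of_pos (by linarith)]; linarith)
      rw [Real.cos_neg] at hrefl
      refine lt_of_le_of_lt ?_ hrefl
      rw [hT, tangentFun, Real.sin_neg, ← hω']
      gcongr
    · have hcos : Real.cos ω ≤ 0 :=
        Real.cos_nonpos_of_pi_div_two_le_of_le hω2.le (by linarith)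
      rw [hT]
      have := Real.cosh_pos (p * Real.cos t')
      nlinarith

theorem tangentFun_lt {p t t' : ℝ} (hp : 0 < p) (hpi : p < Real.pi)
    (hne : Real.sin t ≠ Real.sin t') :
    tangentFun p t (Real.sin t') < Real.cosh (p * Real.cos t') := by
  rcases le_or_gt (p * |Real.sin t' - Real.sin t|) Real.pi with h | h
  · exact tangentFun_lt_of_le hp hne h
  · rcases lt_or_gt_of_ne hne with hlt | hlt
    · have := tangentFun_lt_of_gt (t := -t) (t' := -t') hp hpi (by simpa using hlt) (by
        rw [abs_of_pos (by linarith)] at h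
        simp only [Real.sin_neg]
        linarith)
      rwa [Real.sin_neg, tangentFun_neg, Real.cos_neg] at this
    · refine tangentFun_lt_of_gt hp hpi hlt ?_
      rw [abs_of_neg (by linarith)] at h
      linarith

theorem tangentFun_le {p t t' : ℝ} (hp : 0 < p) (hpi : p < Real.pi) :
    tangentFun p t (Real.sin t') ≤ Real.cosh (p * Real.cos t') := by
  by_cases h : Real.sin t = Real.sin t'
  · have hc : |Real.cos t'| = |Real.cos t| := by
      rw [← sq_eq_sq_iff_abs_eq_abs, Real.cos_sq', Real.cos_sq', h]
    rw [← h, tangentFun_self, Real.cosh_le_cosh, abs_mul, abs_mul, hc]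
  · exact (tangentFun_lt hp hpi h).le

/-! ### One-sided minima -/

theorem nonneg_of_hasDerivAt_of_eventually_le {f : ℝ → ℝ} {d x : ℝ} (hf : HasDerivAt f d x)
    (h : ∀ᶠ y in 𝓝[>] x, f x ≤ f y) : 0 ≤ d := by
  have ht : Tendsto (slope f x) (𝓝[>] x) (𝓝 d) := (hasDerivAt_iff_tendsto_slope.1 hf).mono_left
    (nhdsWithin_mono x fun y (hy : x < y) => (hy.ne' : y ≠ x))
  refine ge_of_tendsto ht ?_
  filter_upwards [h, self_mem_nhdsWithin] with y hy hxy
  rw [slope_def_field]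
  exact div_nonneg (sub_nonneg.2 hy) (sub_nonneg.2 (le_of_lt hxy))

theorem nonpos_of_hasDerivAt_of_eventually_le {f : ℝ → ℝ} {d x : ℝ} (hf : HasDerivAt f d x)
    (h : ∀ᶠ y in 𝓝[<] x, f x ≤ f y) : d ≤ 0 := by
  have ht : Tendsto (slope f x) (𝓝[<] x) (𝓝 d) := (hasDerivAt_iff_tendsto_slope.1 hf).mono_left
    (nhdsWithin_mono x fun y (hy : y < x) => (hy.ne : y ≠ x))
  refine le_of_tendsto ht ?_
  filter_upwards [h, self_mem_nhdsWithin] with y hy hxy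
  rw [slope_def_field]
  exact div_nonpos_of_nonneg_of_nonpos (sub_nonneg.2 hy) (sub_nonpos.2 (le_of_lt hxy))

/-! ### The exponential on the disk of radius `π` -/

theorem log_exp_of_norm_lt_pi {z : ℂ} (hz : ‖z‖ < Real.pi) : Complex.log (Complex.exp z) = z := by
  have h := (Complex.abs_im_le_norm z).trans_lt hz
  rw [abs_lt] at h
  exact Complex.log_exp h.1 h.2.le

theorem eq_of_exp_eq {z w : ℂ} (hz : ‖z‖ < Real.pi) (hw : ‖w‖ < Real.pi)
    (h : Complex.exp z = Complex.exp w) : z = w := by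
  rw [← log_exp_of_norm_lt_pi hz, h, log_exp_of_norm_lt_pi hw]

theorem norm_ofReal_mul_dir {p : ℝ} (hp : 0 ≤ p) (t : ℝ) : ‖(p : ℂ) * dir t‖ = p := by
  rw [norm_mul, norm_dir, mul_one, Complex.norm_real, Real.norm_of_nonneg hp]

theorem exists_eq_norm_mul_dir (z : ℂ) : ∃ t, z = ‖z‖ * dir t :=
  ⟨z.arg, by rw [dir_eq_exp, Complex.norm_mul_exp_arg_mul_I]⟩

/-- A boundary point lies in `exp D̄(0, r)` only if `r` is at least its radius. -/
theorem le_of_boundary_mem_expDisk {p t r : ℝ} (hp : 0 ≤ p) (hpi : p < Real.pi)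
    (h : boundary p t ∈ expDisk r) : p ≤ r := by
  obtain ⟨z, hz, he⟩ := h
  rw [mem_closedBall_zero_iff] at hz
  by_contra! hr
  have hzp : z = p * dir t := eq_of_exp_eq (hz.trans_lt (hr.trans hpi))
    (by rwa [norm_ofReal_mul_dir hp]) he
  rw [hzp, norm_ofReal_mul_dir hp] at hz
  linarith

theorem isClosed_expDisk (p : ℝ) : IsClosed (expDisk p) :=
  ((isCompact_closedBall (0 : ℂ) p).image Complex.continuous_exp).isClosed

theorem coe_angle_eq_of_boundary_eq {p t s : ℝ} (hp : 0 < p) (hpi : p < Real.pi)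
    (h : boundary p s = boundary p t) : (s : Real.Angle) = (t : Real.Angle) := by
  have h1 := eq_of_exp_eq (by rwa [norm_ofReal_mul_dir hp.le])
    (by rwa [norm_ofReal_mul_dir hp.le]) h
  have h2 : dir s = dir t := mul_left_cancel₀ (by exact_mod_cast hp.ne') h1
  refine Real.Angle.cos_sin_inj ?_ ?_
  · simpa using congrArg Complex.re h2
  · simpa using congrArg Complex.im h2

/-! ### Disks tangent to the boundary curve -/

theorem norm_normal (p t : ℝ) : ‖normal p t‖ = 1 := norm_dir _

theorem boundary_mem_tangentDisk (p t : ℝ) {r : ℝ} (hr : 0 ≤ r) :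
    boundary p t ∈ Metric.closedBall (tangentCenter p t r) r := by
  rw [mem_closedBall_iff_norm, tangentCenter, sub_sub_cancel, norm_mul, norm_normal, mul_one,
    Complex.norm_real, Real.norm_of_nonneg hr]

theorem tangentDisk_subset (p t : ℝ) {r R : ℝ} (h : r ≤ R) :
    Metric.closedBall (tangentCenter p t r) r ⊆ Metric.closedBall (tangentCenter p t R) R := by
  refine Metric.closedBall_subset_closedBall' ?_
  have : tangentCenter p t r - tangentCenter p t R = ((R - r : ℝ) : ℂ) * normal p t := by
    simp only [tangentCenter]; push_cast; ring
  rw [dist_eq_norm, this, norm_mul, norm_normal, mul_one, Complex.norm_real,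
    Real.norm_of_nonneg (sub_nonneg.2 h)]
  linarith

theorem eq_boundary_of_mem_tangentDisk {p t r R : ℝ} (hr : 0 ≤ r) (h : r < R) {z : ℂ}
    (hz : z ∈ Metric.closedBall (tangentCenter p t r) r) (hR : R ≤ ‖z - tangentCenter p t R‖) :
    z = boundary p t := by
  rw [mem_closedBall_iff_norm] at hz
  have hn : (normal p t).re * (normal p t).re + (normal p t).im * (normal p t).im = 1 := by
    rw [← Complex.normSq_apply, Complex.normSq_eq_norm_sq, norm_normal]; norm_num
  set n := normal p t with hn'
  set u := z - tangentCenter p t r with hu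
  have h1 : u.re * u.re + u.im * u.im ≤ r ^ 2 := by
    rw [← Complex.normSq_apply, Complex.normSq_eq_norm_sq]
    exact pow_le_pow_left₀ (norm_nonneg _) hz 2
  have h2 : R ^ 2 ≤ (u.re + (R - r) * n.re) * (u.re + (R - r) * n.re)
      + (u.im + (R - r) * n.im) * (u.im + (R - r) * n.im) := by
    have h3 : z - tangentCenter p t R = u + ((R - r : ℝ) : ℂ) * n := by
      simp only [hu, tangentCenter, hn']; push_cast; ring
    have h4 := pow_le_pow_left₀ (hr.trans h.le) hR 2
    rw [← Complex.normSq_eq_norm_sq, h3, Complex.normSq_apply] at h4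
    simpa using h4
  -- The component of `u` along the unit normal is at least `r` while `‖u‖ ≤ r`, which forces `u = r
  -- n`.
  have h5 : r ≤ u.re * n.re + u.im * n.im := by
    have h3 : R ^ 2 ≤ (u.re * u.re + u.im * u.im) + 2 * ((R - r) * (u.re * n.re + u.im * n.im))
        + (R - r) ^ 2 := by linear_combination h2 + (R - r) ^ 2 * hn
    by_contra! h6
    nlinarith [mul_lt_mul_of_pos_left h6 (sub_pos.2 h)]
  have h6 : (u.re - r * n.re) * (u.re - r * n.re) + (u.im - r * n.im) * (u.im - r * n.im) ≤ 0 := by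
    linear_combination h1 + 2 * mul_le_mul_of_nonneg_left h5 hr + r ^ 2 * hn
  have h7 : u - r * n = 0 := by
    apply Complex.ext
    · simp; nlinarith [mul_self_nonneg (u.re - r * n.re), mul_self_nonneg (u.im - r * n.im)]
    · simp; nlinarith [mul_self_nonneg (u.re - r * n.re), mul_self_nonneg (u.im - r * n.im)]
  have h8 : z - boundary p t = u - r * n := by
    simp only [hu, tangentCenter, hn']; ring
  rw [← sub_eq_zero, h8, h7]

theorem norm_boundary_sub_tangentCenter_sq (p' t' p t r : ℝ) :
    ‖boundary p' t' - tangentCenter p t r‖ ^ 2 = r ^ 2 + Real.exp (p' * Real.cos t') ^ 2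
      + Real.exp (p * Real.cos t) ^ 2 - 2 * Real.exp (p * Real.cos t) * r * Real.cos t
      - 2 * Real.exp (p' * Real.cos t') * (Real.cos (p' * Real.sin t' - p * Real.sin t)
          * (Real.exp (p * Real.cos t) - r * Real.cos t)
        - Real.sin (p' * Real.sin t' - p * Real.sin t) * (r * Real.sin t)) := by
  rw [← Complex.normSq_eq_norm_sq, Complex.normSq_apply, tangentCenter, boundary_eq, boundary_eq,
    normal, Real.cos_sub, Real.sin_sub]
  simp only [Complex.sub_re, Complex.sub_im, Complex.re_ofReal_mul, Complex.im_ofReal_mul, dir_re,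
    dir_im, Real.cos_add, Real.sin_add]
  have hA := Real.sin_sq_add_cos_sq (p' * Real.sin t')
  have hB := Real.sin_sq_add_cos_sq (p * Real.sin t)
  have hT := Real.sin_sq_add_cos_sq t
  generalize Real.sin (p' * Real.sin t') = sa at *
  generalize Real.cos (p' * Real.sin t') = ca at *
  generalize Real.sin (p * Real.sin t) = sb at *
  generalize Real.cos (p * Real.sin t) = cb at *
  generalize Real.exp (p' * Real.cos t') = E
  generalize Real.exp (p * Real.cos t) = P
  generalize Real.sin t = st at *
  generalize Real.cos t = ct at *
  linear_combination E ^ 2 * hA + (P ^ 2 + r ^ 2 * (st ^ 2 + ct ^ 2) - 2 * P * r * ct) * hB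
    + r ^ 2 * hT

/-- The link between disks and `tangentFun`. For `S = sinhDiv p c`, `c = cos t`, one has `e^{pc} - S
c = cosh (p c)` and `e^{2pc} - 2 S c e^{pc} = cosh² - sinh² = 1`; the latter combines with `e^{2x}`
into `2 e^x cosh x`, where `x = p cos t'`. -/
theorem norm_boundary_sub_tangentCenter_sinhDiv_sq (p t t' : ℝ) :
    ‖boundary p t' - tangentCenter p t (sinhDiv p (Real.cos t))‖ ^ 2
      = sinhDiv p (Real.cos t) ^ 2 + 2 * Real.exp (p * Real.cos t')
        * (Real.cosh (p * Real.cos t') - tangentFun p t (Real.sin t')) := by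
  rw [norm_boundary_sub_tangentCenter_sq, tangentFun, mul_sub p]
  have h1 := mul_sinhDiv p (Real.cos t)
  have h2 : Real.exp (p * Real.cos t)
      = Real.cosh (p * Real.cos t) + Real.cos t * sinhDiv p (Real.cos t) := by
    rw [h1, Real.cosh_add_sinh]
  have h3 : Real.cosh (p * Real.cos t) ^ 2 = 1 + (Real.cos t * sinhDiv p (Real.cos t)) ^ 2 := by
    rw [h1, Real.cosh_sq, add_comm]
  have h4 : Real.exp (p * Real.cos t') * (2 * Real.cosh (p * Real.cos t'))
      = Real.exp (p * Real.cos t') ^ 2 + 1 := by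
    rw [Real.cosh_eq, Real.exp_neg]
    field_simp
  rw [h2]
  linear_combination -h4 + h3

theorem sinhDiv_le_norm_boundary_sub {p : ℝ} (hp : 0 < p) (hpi : p < Real.pi) (t t' : ℝ) :
    sinhDiv p (Real.cos t) ≤ ‖boundary p t' - tangentCenter p t (sinhDiv p (Real.cos t))‖ := by
  refine le_of_sq_le_sq ?_ (norm_nonneg _)
  rw [norm_boundary_sub_tangentCenter_sinhDiv_sq]
  have := mul_nonneg (Real.exp_pos (p * Real.cos t')).le
    (sub_nonneg.2 (tangentFun_le (t := t) (t' := t') hp hpi))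
  linarith

theorem sin_eq_of_boundary_mem {p t t' : ℝ} (hp : 0 < p) (hpi : p < Real.pi)
    (h : boundary p t' ∈ Metric.closedBall (tangentCenter p t (sinhDiv p (Real.cos t)))
      (sinhDiv p (Real.cos t))) : Real.sin t = Real.sin t' := by
  by_contra hne
  rw [mem_closedBall_iff_norm] at h
  have h1 := pow_le_pow_left₀ (norm_nonneg _) h 2
  rw [norm_boundary_sub_tangentCenter_sinhDiv_sq] at h1
  have := mul_pos (Real.exp_pos (p * Real.cos t')) (sub_pos.2 (tangentFun_lt hp hpi hne))
  linarith

/-! ### Derivatives of the distance to a point -/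

/-- The left side is the radial derivative of `boundary`, and the angular derivative is `p i` times
it. Hence below, with `ζ` the coordinate relative to the normal, `ζ.re` governs radial and `ζ.im`
angular motion. -/
theorem dir_mul_boundary (p t : ℝ) :
    dir t * boundary p t = Real.exp (p * Real.cos t) * normal p t := by
  rw [boundary_eq, normal, dir_add]; ring

theorem hasDerivAt_norm_boundary_sub_sq_radial (p t : ℝ) {w ζ : ℂ}
    (hw : boundary p t - w = ζ * normal p t) :
    HasDerivAt (fun ρ => ‖boundary ρ t - w‖ ^ 2)
      (2 * (Real.exp (p * Real.cos t) * ζ.re)) p := by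
  have h1 : HasDerivAt (fun ρ : ℝ => boundary ρ t - w) (dir t * boundary p t) p := by
    have h : HasDerivAt (fun ρ : ℝ => (ρ : ℂ) * dir t) (dir t) p := by
      simpa using (Complex.ofRealCLM.hasDerivAt (x := p)).mul_const (dir t)
    simpa [boundary, mul_comm] using (h.cexp).sub_const w
  refine h1.norm_sq.congr_deriv ?_
  have hn : (normal p t).re * (normal p t).re + (normal p t).im * (normal p t).im = 1 := by
    rw [← Complex.normSq_apply, Complex.normSq_eq_norm_sq, norm_normal]; norm_num
  rw [hw, dir_mul_boundary, Complex.inner]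
  generalize Real.exp (p * Real.cos t) = P
  simp
  linear_combination (P * ζ.re) * hn

theorem hasDerivAt_norm_boundary_sub_sq_angular (p t : ℝ) {w ζ : ℂ}
    (hw : boundary p t - w = ζ * normal p t) :
    HasDerivAt (fun x => ‖boundary p x - w‖ ^ 2)
      (2 * (p * Real.exp (p * Real.cos t) * ζ.im)) t := by
  have h1 : HasDerivAt (fun x : ℝ => boundary p x - w)
      (p * Complex.I * (dir t * boundary p t)) t := by
    have h : HasDerivAt (fun x : ℝ => (p : ℂ) * dir x) (p * (Complex.I * dir t)) t := by
      simp only [dir_eq_exp]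
      have h0 : HasDerivAt (fun x : ℝ => (x : ℂ) * Complex.I) Complex.I t := by
        simpa using (Complex.ofRealCLM.hasDerivAt (x := t)).mul_const Complex.I
      simpa [mul_comm] using h0.cexp.const_mul (p : ℂ)
    refine ((h.cexp).sub_const w).congr_deriv ?_
    rw [boundary]; ring
  refine h1.norm_sq.congr_deriv ?_
  have hn : (normal p t).re * (normal p t).re + (normal p t).im * (normal p t).im = 1 := by
    rw [← Complex.normSq_apply, Complex.normSq_eq_norm_sq, norm_normal]; norm_num
  rw [hw, dir_mul_boundary, Complex.inner]
  generalize Real.exp (p * Real.cos t) = P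
  simp
  linear_combination (p * P * ζ.im) * hn

/-! ### Tangent disks and `exp D̄(0, p)` -/

theorem expDisk_zero : expDisk 0 = {1} := by
  simp [expDisk]

@[simp] theorem boundary_zero (t : ℝ) : boundary 0 t = 1 := by simp [boundary]

/-- The maximal tangent disk lies in `exp D̄(0, p)`. -/
theorem tangentDisk_sinhDiv_subset {p : ℝ} (hp : 0 ≤ p) (hpi : p < Real.pi) (t : ℝ) :
    Metric.closedBall (tangentCenter p t (sinhDiv p (Real.cos t))) (sinhDiv p (Real.cos t))
      ⊆ expDisk p := by
  rcases hp.eq_or_lt with rfl | hp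
  · simp [expDisk_zero, tangentCenter]
  set S := sinhDiv p (Real.cos t) with hS
  have hS0 : 0 < S := sinhDiv_pos hp _
  rw [← closure_ball _ hS0.ne']
  refine closure_minimal ?_ (isClosed_expDisk p)
  have hU : IsOpen (Complex.exp '' Metric.ball (0 : ℂ) p) :=
    Complex.isOpenMap_exp _ Metric.isOpen_ball
  have hUsub : Complex.exp '' Metric.ball (0 : ℂ) p ⊆ expDisk p :=
    Set.image_mono Metric.ball_subset_closedBall
  -- The open tangent disk avoids the boundary curve, so it is covered by two disjoint open sets,
  -- the image of the open disk and the complement of `exp D̄(0, p)`. Being connected, it lies in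
  -- the first as soon as it meets it.
  refine Set.Subset.trans (IsPreconnected.subset_left_of_subset_union hU
    (isClosed_expDisk p).isOpen_compl (Set.disjoint_compl_right_iff_subset.2 hUsub) ?_ ?_
    (convex_ball _ _).isPreconnected) hUsub
  · intro z hz
    by_cases hzp : z ∈ expDisk p
    · left
      obtain ⟨ζ, hζ, rfl⟩ := hzp
      rw [mem_closedBall_zero_iff] at hζ
      refine ⟨ζ, ?_, rfl⟩
      rw [mem_ball_zero_iff]
      refine lt_of_le_of_ne hζ fun he => ?_
      obtain ⟨t', ht'⟩ := exists_eq_norm_mul_dir ζ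
      rw [he] at ht'
      have h1 := sinhDiv_le_norm_boundary_sub hp hpi t t'
      rw [boundary, ← ht'] at h1
      rw [mem_ball_iff_norm] at hz
      exact absurd h1 (not_le.2 hz)
    · exact Or.inr hzp
  -- A common point is found by moving slightly inward from the point of tangency, where the radial
  -- derivative of the distance is positive.
  · have hd := hasDerivAt_norm_boundary_sub_sq_radial p t (w := tangentCenter p t S) (ζ := (S : ℂ))
      (by rw [tangentCenter]; ring)
    have hpos : 0 < 2 * (Real.exp (p * Real.cos t) * (S : ℂ).re) := by
      rw [Complex.ofReal_re]; positivity
    have hex : ∃ᶠ ρ in 𝓝[<] p, ‖boundary ρ t - tangentCenter p t S‖ ^ 2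
        < ‖boundary p t - tangentCenter p t S‖ ^ 2 := by
      intro hn
      refine absurd (nonpos_of_hasDerivAt_of_eventually_le hd ?_) (not_le.2 hpos)
      filter_upwards [hn] with ρ hρ using not_lt.1 hρ
    obtain ⟨ρ, hρ, hρ0, hρp⟩ :=
      (hex.and_eventually (Ioo_mem_nhdsLT hp)).exists
    refine ⟨boundary ρ t, ?_, ρ * dir t, ?_, rfl⟩
    · have h1 := boundary_mem_tangentDisk p t hS0.le
      rw [mem_closedBall_iff_norm] at h1
      rw [mem_ball_iff_norm]
      exact (lt_of_pow_lt_pow_left₀ 2 (norm_nonneg _) hρ).trans_le h1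
    · rwa [mem_ball_zero_iff, norm_ofReal_mul_dir hρ0.le]

/-- For `p < x < π` the points `boundary x t` lie outside `exp D̄(0, p)`, hence outside the disk;
letting `x` decrease to `ρ` covers `ρ = p` as well. -/
theorem radius_le_norm_boundary_sub {p r : ℝ} {w : ℂ} (hp : 0 ≤ p)
    (h : Metric.closedBall w r ⊆ expDisk p) {ρ : ℝ} (hρ : p ≤ ρ) (hρpi : ρ < Real.pi) (t : ℝ) :
    r ≤ ‖boundary ρ t - w‖ := by
  have hcont : Continuous fun ρ => ‖boundary ρ t - w‖ := by unfold boundary; fun_prop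
  refine ge_of_tendsto (hcont.continuousAt.tendsto.mono_left
    (nhdsWithin_le_nhds (s := Set.Ioi ρ))) ?_
  filter_upwards [Ioo_mem_nhdsGT hρpi] with x hx
  by_contra! hlt
  have := le_of_boundary_mem_expDisk (hp.trans (hρ.trans hx.1.le)) hx.2
    (h (mem_closedBall_iff_norm.2 hlt.le))
  linarith [hx.1]

/-- A disk in `exp D̄(0, p)` that reaches the boundary curve is tangent to it. -/
theorem eq_tangentCenter {p r t : ℝ} {w : ℂ} (hp : 0 < p) (hpi : p < Real.pi) (hr : 0 ≤ r)
    (h : Metric.closedBall w r ⊆ expDisk p) (ht : boundary p t ∈ Metric.closedBall w r) :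
    w = tangentCenter p t r := by
  have hn : normal p t ≠ 0 := norm_pos_iff.1 (by rw [norm_normal]; exact one_pos)
  have hnorm : ‖boundary p t - w‖ = r :=
    le_antisymm (mem_closedBall_iff_norm.1 ht) (radius_le_norm_boundary_sub hp.le h le_rfl hpi t)
  obtain ⟨ζ, hζ⟩ : ∃ ζ, boundary p t - w = ζ * normal p t :=
    ⟨(boundary p t - w) / normal p t, by rw [div_mul_cancel₀ _ hn]⟩
  have hle : ∀ ρ, p ≤ ρ → ρ < Real.pi → ∀ t',
      ‖boundary p t - w‖ ^ 2 ≤ ‖boundary ρ t' - w‖ ^ 2 := fun ρ hρ hρpi t' => by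
    rw [hnorm]
    exact pow_le_pow_left₀ hr (radius_le_norm_boundary_sub hp.le h hρ hρpi t') 2
  -- The touching point is nearest to `w` on the curve, so the angular derivative vanishes; moving
  -- outward cannot come closer, so `ζ.re` is nonnegative.
  have him : ζ.im = 0 := by
    have hmin : IsLocalMin (fun x => ‖boundary p x - w‖ ^ 2) t :=
      Eventually.of_forall fun x => hle p le_rfl hpi x
    have := hmin.hasDerivAt_eq_zero (hasDerivAt_norm_boundary_sub_sq_angular p t hζ)
    have hE := Real.exp_pos (p * Real.cos t)
    simpa [hp.ne', hE.ne'] using this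
  have hre : 0 ≤ ζ.re := by
    have h1 := nonneg_of_hasDerivAt_of_eventually_le
      (hasDerivAt_norm_boundary_sub_sq_radial p t hζ) (by
        filter_upwards [Ioo_mem_nhdsGT hpi] with ρ hρ using hle ρ hρ.1.le hρ.2 t)
    have hE := Real.exp_pos (p * Real.cos t)
    by_contra! hneg
    nlinarith [mul_neg_of_pos_of_neg hE hneg]
  have hζr : ζ = r := by
    have h1 : ζ = (ζ.re : ℂ) := Complex.ext rfl (by simpa using him)
    rw [hζ, norm_mul, norm_normal, mul_one, h1, Complex.norm_real, Real.norm_of_nonneg hre] at hnorm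
    rw [h1, hnorm]
  rw [tangentCenter, ← hζr, ← hζ, sub_sub_cancel]

theorem radius_le_sinhDiv {p r t : ℝ} (hp : 0 < p)
    (h : ∀ t', r ^ 2 ≤ ‖boundary p t' - tangentCenter p t r‖ ^ 2) :
    r ≤ sinhDiv p (Real.cos t) := by
  simp only [norm_boundary_sub_tangentCenter_sq] at h
  -- If `cos t ≠ 0`, the curve point at `π - t` is the right test. If `cos t = 0`, that point is `t`
  -- itself, and a limiting comparison with nearby points is needed.
  by_cases hc : Real.cos t = 0
  · have hs : Real.sin t ^ 2 = 1 := by rw [Real.sin_sq, hc]; ring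
    have key : ∀ κ ∈ Set.Ioo (0 : ℝ) 1,
        0 ≤ Real.exp (p ^ 2 * κ) - Real.cos (p * κ) - r * Real.sin (p * κ) := by
      intro κ hκ
      obtain ⟨τ, hτ⟩ : ∃ τ, Real.cos τ = 1 - κ :=
        ⟨Real.arccos (1 - κ), Real.cos_arccos (by linarith [hκ.2]) (by linarith [hκ.1])⟩
      have h1 := h (t + τ)
      rw [hc, Real.cos_add, Real.sin_add, hc, hτ] at h1
      set x := p * (0 * (1 - κ) - Real.sin t * Real.sin τ) with hx
      have hψ : p * (Real.sin t * (1 - κ) + 0 * Real.sin τ) - p * Real.sin t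
          = -(Real.sin t * (p * κ)) := by ring
      have hcosψ : Real.cos (Real.sin t * (p * κ)) = Real.cos (p * κ) := by
        rcases sq_eq_one_iff.1 hs with h | h <;> rw [h] <;> simp
      have hsinψ : Real.sin (Real.sin t * (p * κ)) * Real.sin t = Real.sin (p * κ) := by
        rcases sq_eq_one_iff.1 hs with h | h <;> rw [h] <;> simp
      rw [hψ, Real.cos_neg, Real.sin_neg, hcosψ] at h1
      have hE := Real.exp_pos x
      have hcosh : 2 * Real.cosh x * Real.exp x = Real.exp x ^ 2 + 1 := by
        rw [Real.cosh_eq, Real.exp_neg]; field_simp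
      have h2 : 0 ≤ 2 * Real.exp x
          * (Real.cosh x - Real.cos (p * κ) - r * Real.sin (p * κ)) := by
        simp only [mul_zero, Real.exp_zero, sub_zero] at h1
        linear_combination h1 - hcosh - 2 * Real.exp x * r * hsinψ
      have h3 := nonneg_of_mul_nonneg_right h2 (by positivity)
      -- With `cosh x ≤ exp (x² / 2)` this gives an inequality in `κ` alone, with equality at `κ =
      -- 0`; its derivative there is `p² - r p`, whence `r ≤ p`.
      have h4 : x ^ 2 / 2 ≤ p ^ 2 * κ := by
        have : x ^ 2 = p ^ 2 * (1 - (1 - κ) ^ 2) := by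
          rw [← hτ, ← Real.sin_sq, hx]
          linear_combination p ^ 2 * Real.sin τ ^ 2 * hs
        rw [this]
        nlinarith [mul_nonneg (sq_nonneg p) (sq_nonneg κ)]
      have h5 := (Real.cosh_le_exp_half_sq x).trans (Real.exp_le_exp.2 h4)
      linarith
    have hd : HasDerivAt
        (fun κ => Real.exp (p ^ 2 * κ) - Real.cos (p * κ) - r * Real.sin (p * κ))
        (p ^ 2 - r * p) 0 := by
      have h1 : HasDerivAt (fun κ : ℝ => p ^ 2 * κ) (p ^ 2) 0 := by
        simpa using (hasDerivAt_id' (0 : ℝ)).const_mul (p ^ 2)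
      have h2 : HasDerivAt (fun κ : ℝ => p * κ) p 0 := by
        simpa using (hasDerivAt_id' (0 : ℝ)).const_mul p
      refine ((h1.exp.sub h2.cos).sub (h2.sin.const_mul r)).congr_deriv ?_
      simp
    have h6 := nonneg_of_hasDerivAt_of_eventually_le hd (by
      filter_upwards [Ioo_mem_nhdsGT (zero_lt_one' ℝ)] with κ hκ
      simpa using key κ hκ)
    have h7 : r ≤ p := le_of_mul_le_mul_right (by linarith) hp
    simpa [sinhDiv, hc] using h7
  · have h1 := h (Real.pi - t)
    rw [Real.cos_pi_sub, Real.sin_pi_sub, sub_self, Real.cos_zero, Real.sin_zero] at h1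
    have h2 : Real.exp (p * Real.cos t) = Real.exp (p * -Real.cos t)
        + 2 * (Real.cos t * sinhDiv p (Real.cos t)) := by
      rw [mul_sinhDiv, Real.sinh_eq, mul_neg]; ring
    have h3 : Real.exp (p * Real.cos t) * Real.exp (p * -Real.cos t) = 1 := by
      rw [← Real.exp_add, mul_neg, add_neg_cancel, Real.exp_zero]
    have hS := sinhDiv_pos hp (Real.cos t)
    have hc2 : 0 < Real.cos t ^ 2 := by positivity
    -- The points at `t` and `π - t` have the same argument and moduli differing by `2 cos t · S`,
    -- so the distance condition factors in this way.
    have h4 : 0 ≤ 4 * Real.cos t ^ 2 * sinhDiv p (Real.cos t) * (sinhDiv p (Real.cos t) - r) := by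
      generalize Real.exp (p * -Real.cos t) = E at *
      rw [h2] at h1
      linear_combination h1
    have h5 := nonneg_of_mul_nonneg_right h4 (by positivity)
    linarith

theorem tangent_of_subset_expDisk {p r t : ℝ} {w : ℂ} (hp : 0 ≤ p) (hpi : p < Real.pi)
    (hr : 0 ≤ r) (h : Metric.closedBall w r ⊆ expDisk p)
    (ht : boundary p t ∈ Metric.closedBall w r) :
    w = tangentCenter p t r ∧ r ≤ sinhDiv p (Real.cos t) := by
  rcases hp.eq_or_lt with rfl | hp
  · rw [expDisk_zero] at h
    have h1 : w = 1 := h (Metric.mem_closedBall_self hr)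
    have h2 : w + r = 1 := h (by
      rw [mem_closedBall_iff_norm, add_sub_cancel_left, Complex.norm_real, Real.norm_of_nonneg hr])
    have h3 : r = 0 := by
      rw [h1] at h2
      exact_mod_cast add_eq_left.1 h2
    simp [h1, h3, tangentCenter]
  · have hw := eq_tangentCenter hp hpi hr h ht
    refine ⟨hw, radius_le_sinhDiv hp fun t' => ?_⟩
    rw [← hw]
    exact pow_le_pow_left₀ hr (radius_le_norm_boundary_sub hp.le h le_rfl hpi t') 2

/-! ### The radius of the normal form -/

theorem nwRadius_zero_left (p t : ℝ) : nwRadius 0 p t = sinhDiv p (Real.cos t) := by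
  simp [nwRadius]

/-- For `c = cos t ≠ 0` the radius is `(e^{(p₁ + p₂) c} - e^{(p₁ - p₂) c}) / (2 c)`, so with the sum
fixed the differences telescope. The added radius is positive when `p₂ < q₂`, which gives strict
monotonicity. -/
theorem nwRadius_add {p₁ p₂ q₁ q₂ : ℝ} (h : p₁ + p₂ = q₁ + q₂) (t : ℝ) :
    nwRadius q₁ q₂ t = nwRadius p₁ p₂ t + nwRadius (p₁ - q₂) (q₂ - p₂) t := by
  have hq₁ : q₁ = p₁ + p₂ - q₂ := by linarith
  subst hq₁
  by_cases hc : Real.cos t = 0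
  · simp [nwRadius, sinhDiv, hc]
  · refine mul_left_cancel₀ hc ?_
    simp only [nwRadius]
    rw [mul_add, mul_left_comm, mul_sinhDiv, mul_left_comm, mul_sinhDiv, mul_left_comm,
      mul_sinhDiv]
    simp only [Real.sinh_eq, mul_div_assoc', mul_sub, ← Real.exp_add]
    ring_nf

theorem nwRadius_lt {p₁ p₂ q₁ q₂ : ℝ} (h : p₁ + p₂ = q₁ + q₂) (hlt : p₂ < q₂) (t : ℝ) :
    nwRadius p₁ p₂ t < nwRadius q₁ q₂ t := by
  rw [nwRadius_add h]
  exact lt_add_of_pos_right _ (mul_pos (Real.exp_pos _) (sinhDiv_pos (sub_pos.2 hlt) _))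

theorem nwRadius_lt_sinhDiv {p₁ : ℝ} (h : 0 < p₁) (p₂ t : ℝ) :
    nwRadius p₁ p₂ t < sinhDiv (p₁ + p₂) (Real.cos t) := by
  rw [← nwRadius_zero_left]
  exact nwRadius_lt (zero_add _).symm (by linarith) t

theorem nwRadius_le_sinhDiv {p₁ : ℝ} (h : 0 ≤ p₁) (p₂ t : ℝ) :
    nwRadius p₁ p₂ t ≤ sinhDiv (p₁ + p₂) (Real.cos t) := by
  rcases h.eq_or_lt with rfl | h
  · rw [nwRadius_zero_left, zero_add]
  · exact (nwRadius_lt_sinhDiv h p₂ t).le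

theorem exists_nwRadius_eq {p r t : ℝ} (hp : 0 ≤ p) (hr : 0 ≤ r)
    (h : r ≤ sinhDiv p (Real.cos t)) :
    ∃ p₁ p₂ : ℝ, 0 ≤ p₁ ∧ 0 ≤ p₂ ∧ p = p₁ + p₂ ∧ nwRadius p₁ p₂ t = r := by
  have hcont : Continuous fun x => nwRadius (p - x) x t := by
    have h1 : Continuous fun x => sinhDiv x (Real.cos t) := by
      unfold sinhDiv
      split_ifs <;> fun_prop
    unfold nwRadius
    fun_prop
  obtain ⟨x, hx, hxr⟩ := intermediate_value_Icc hp hcont.continuousOn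
    (show r ∈ Set.Icc (nwRadius (p - 0) 0 t) (nwRadius (p - p) p t) by
      rw [sub_self, nwRadius_zero_left]
      exact ⟨by simpa [nwRadius] using hr, h⟩)
  exact ⟨p - x, x, sub_nonneg.2 hx.2, hx.1, by ring, hxr⟩

/-! ### Presentations -/

section Presents

variable {A F : M2} {p₁ p₂ t : ℝ}

theorem Presents.CD_eq (h : Presents A p₁ p₂ t F) :
    CD A = Metric.closedBall (tangentCenter (p₁ + p₂) t (nwRadius p₁ p₂ t))
      (nwRadius p₁ p₂ t) := by
  rw [h.eq_NW, CD_NW p₁ t h.mem_KK h.nonneg_right]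

theorem Presents.radius_eq (h : Presents A p₁ p₂ t F) : chiralRadius A = nwRadius p₁ p₂ t := by
  rw [h.eq_NW, NW_eq_conf_add,
    chiralRadius_conf_add h.mem_KK _ (nwRadius_nonneg _ h.nonneg_right _)]

theorem Presents.CD_subset_tangentDisk (h : Presents A p₁ p₂ t F) :
    CD A ⊆ Metric.closedBall (tangentCenter (p₁ + p₂) t (sinhDiv (p₁ + p₂) (Real.cos t)))
      (sinhDiv (p₁ + p₂) (Real.cos t)) := by
  rw [h.CD_eq]
  exact tangentDisk_subset _ _ (nwRadius_le_sinhDiv h.nonneg_left _ _)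

theorem Presents.CD_subset (h : Presents A p₁ p₂ t F) : CD A ⊆ expDisk (p₁ + p₂) :=
  h.CD_subset_tangentDisk.trans
    (tangentDisk_sinhDiv_subset (add_nonneg h.nonneg_left h.nonneg_right) h.lt_pi t)

theorem Presents.boundary_mem (h : Presents A p₁ p₂ t F) : boundary (p₁ + p₂) t ∈ CD A := by
  rw [h.CD_eq]
  exact boundary_mem_tangentDisk _ _ (nwRadius_nonneg _ h.nonneg_right _)

/-- The sum is determined by `A`: each presentation puts `CD A` in its own exponential disk and has
a touching point that bounds the other sum from below. -/
theorem Presents.add_eq {q₁ q₂ s : ℝ} {G : M2} (h : Presents A p₁ p₂ t F)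
    (h' : Presents A q₁ q₂ s G) : q₁ + q₂ = p₁ + p₂ :=
  le_antisymm
    (le_of_boundary_mem_expDisk (add_nonneg h'.nonneg_left h'.nonneg_right) h'.lt_pi
      (h.CD_subset h'.boundary_mem))
    (le_of_boundary_mem_expDisk (add_nonneg h.nonneg_left h.nonneg_right) h.lt_pi
      (h'.CD_subset h.boundary_mem))

theorem Presents.eq_zero_iff (h : Presents A p₁ p₂ t F) : (p₁ = 0 ∧ p₂ = 0) ↔ A = 1 := by
  constructor
  · rintro ⟨rfl, rfl⟩
    rw [h.eq_NW, NW_eq_conf_add]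
    simp [nwRadius, tangentCenter]
  · intro hA
    have hCD : CD A = {1} := by
      have h1 : (1 : M2) = conf 1 + (0 : ℝ) • F := by simp
      rw [hA, h1, CD_conf_add h.mem_KK _ le_rfl, Metric.closedBall_zero]
    have h1 := h.boundary_mem
    rw [hCD, ← expDisk_zero] at h1
    have := le_of_boundary_mem_expDisk (add_nonneg h.nonneg_left h.nonneg_right) h.lt_pi h1
    constructor <;> linarith [h.nonneg_left, h.nonneg_right]

theorem Presents.right_eq_zero_iff (h : Presents A p₁ p₂ t F) :
    p₂ = 0 ↔ ∃ z : ℂ, CD A = {z} := by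
  rw [h.CD_eq]
  constructor
  · rintro rfl
    exact ⟨tangentCenter (p₁ + 0) t (nwRadius p₁ 0 t), by simp [nwRadius]⟩
  · rintro ⟨z, hz⟩
    have hr := nwRadius_nonneg p₁ h.nonneg_right t
    set w := tangentCenter (p₁ + p₂) t (nwRadius p₁ p₂ t)
    have h1 : w = z := by
      have := Metric.mem_closedBall_self (x := w) hr
      rwa [hz] at this
    have h2 : w + nwRadius p₁ p₂ t = z := by
      have : w + nwRadius p₁ p₂ t ∈ Metric.closedBall w (nwRadius p₁ p₂ t) := by
        rw [mem_closedBall_iff_norm, add_sub_cancel_left, Complex.norm_real,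
          Real.norm_of_nonneg hr]
      rwa [hz] at this
    have h3 : nwRadius p₁ p₂ t = 0 := by
      rw [h1] at h2
      exact_mod_cast add_eq_left.1 h2
    by_contra hne
    exact (mul_pos (Real.exp_pos _)
      (sinhDiv_pos (lt_of_le_of_ne h.nonneg_right (Ne.symm hne)) _)).ne' h3

theorem NW_zero_right (p t : ℝ) (F F' : M2) : NW p 0 t F = NW p 0 t F' := by
  simp [NW]

theorem Presents.left_eq_zero_iff (h : Presents A p₁ p₂ t F) :
    p₁ = 0 ↔ IsMaximalDisk (CD A) (expDisk (p₁ + p₂)) := by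
  have hp := add_nonneg h.nonneg_left h.nonneg_right
  have hr := nwRadius_nonneg p₁ h.nonneg_right t
  constructor
  · rintro rfl
    refine ⟨⟨_, _, hr, h.CD_eq⟩, h.CD_subset, fun c r hr' hsub hsub' => ?_⟩
    refine (Set.Subset.antisymm hsub ?_).symm
    -- A larger disk still contains the touching point, so it is tangent there with radius at most
    -- that of `CD A`.
    obtain ⟨hc, hle⟩ := tangent_of_subset_expDisk hp h.lt_pi hr' hsub' (hsub h.boundary_mem)
    rw [h.CD_eq, nwRadius_zero_left, hc]
    rw [zero_add] at *
    exact tangentDisk_subset _ _ hle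
  · rintro ⟨-, -, hmax⟩
    by_contra hne
    have hlt := nwRadius_lt_sinhDiv (lt_of_le_of_ne h.nonneg_left (Ne.symm hne)) p₂ t
    have heq := hmax _ _ (hr.trans hlt.le) h.CD_subset_tangentDisk
      (tangentDisk_sinhDiv_subset hp h.lt_pi t)
    set R := sinhDiv (p₁ + p₂) (Real.cos t)
    -- The point of the maximal disk opposite to the point of tangency is at distance `2 R - r > r`
    -- from the center of `CD A`.
    have hmem : tangentCenter (p₁ + p₂) t R - R * normal (p₁ + p₂) t ∈ CD A := by
      rw [← heq, mem_closedBall_iff_norm, sub_sub_cancel_left, norm_neg, norm_mul, norm_normal,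
        mul_one, Complex.norm_real, Real.norm_of_nonneg (hr.trans hlt.le)]
    rw [h.CD_eq, mem_closedBall_iff_norm] at hmem
    have : tangentCenter (p₁ + p₂) t R - R * normal (p₁ + p₂) t
        - tangentCenter (p₁ + p₂) t (nwRadius p₁ p₂ t)
        = -(((2 * R - nwRadius p₁ p₂ t : ℝ) : ℂ) * normal (p₁ + p₂) t) := by
      simp only [tangentCenter]; push_cast; ring
    rw [this, norm_neg, norm_mul, norm_normal, mul_one, Complex.norm_real,
      Real.norm_of_nonneg (by linarith)] at hmem
    linarith

theorem NW_congr {s t : ℝ} (hc : Real.cos s = Real.cos t) (hs : Real.sin s = Real.sin t)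
    (p₁ p₂ : ℝ) (F : M2) : NW p₁ p₂ s F = NW p₁ p₂ t F := by
  rw [NW, NW, hc, hs]

theorem NW_zero_left_pi_sub (p t : ℝ) (F : M2) : NW 0 p (Real.pi - t) F = NW 0 p t F := by
  simp [NW, Real.cos_pi_sub, sinhDiv_neg]

theorem eq_of_NW_eq (hp : 0 < p₂) {F G : M2} (h : NW p₁ p₂ t F = NW p₁ p₂ t G) : F = G := by
  rw [NW_eq_conf_add, NW_eq_conf_add] at h
  exact smul_right_injective M2 (mul_pos (Real.exp_pos _) (sinhDiv_pos hp _)).ne'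
    (add_left_cancel h)

theorem cos_sin_eq_of_coe_eq {s t : ℝ} (h : (s : Real.Angle) = (t : Real.Angle)) :
    Real.cos s = Real.cos t ∧ Real.sin s = Real.sin t := by
  rw [← Real.Angle.cos_coe, ← Real.Angle.sin_coe, h, Real.Angle.cos_coe, Real.Angle.sin_coe]
  exact ⟨rfl, rfl⟩

theorem Presents.unique (h : Presents A p₁ p₂ t F) (h₁ : 0 < p₁) (h₂ : 0 < p₂) {q₁ q₂ s : ℝ}
    {G : M2} (h' : Presents A q₁ q₂ s G) :
    q₁ = p₁ ∧ q₂ = p₂ ∧ (s : Real.Angle) = (t : Real.Angle) ∧ G = F := by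
  have hadd := h.add_eq h'
  have hmem := h'.boundary_mem
  rw [hadd, h.CD_eq] at hmem
  -- With `p₁ > 0` the disk is strictly smaller than the maximal one, so it meets the curve at a
  -- single point; the angle is fixed, and then the radius fixes `p₂`.
  have hb : boundary (p₁ + p₂) s = boundary (p₁ + p₂) t :=
    eq_boundary_of_mem_tangentDisk (nwRadius_nonneg p₁ h₂.le t) (nwRadius_lt_sinhDiv h₁ p₂ t) hmem
      (sinhDiv_le_norm_boundary_sub (add_pos h₁ h₂) h.lt_pi t s)
  have hang := coe_angle_eq_of_boundary_eq (add_pos h₁ h₂) h.lt_pi hb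
  obtain ⟨hc, hs⟩ := cos_sin_eq_of_coe_eq hang
  have hrad : nwRadius q₁ q₂ t = nwRadius p₁ p₂ t := by
    rw [← h.radius_eq, h'.radius_eq, nwRadius, nwRadius, hc]
  have hq₂ : q₂ = p₂ := by
    rcases lt_trichotomy q₂ p₂ with hlt | heq | hlt
    · exact absurd hrad (nwRadius_lt hadd hlt t).ne
    · exact heq
    · exact absurd hrad (nwRadius_lt hadd.symm hlt t).ne'
  have hq₁ : q₁ = p₁ := by linarith
  subst hq₁ hq₂
  refine ⟨rfl, rfl, hang, eq_of_NW_eq h₂ (t := t) (p₁ := q₁) ?_⟩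
  rw [← h.eq_NW, ← NW_congr hc hs, ← h'.eq_NW]

theorem Presents.iff_of_left_eq_zero (h : Presents A 0 p₂ t F) (h₂ : 0 < p₂) (q₁ q₂ s : ℝ)
    (G : M2) : Presents A q₁ q₂ s G ↔ (q₁ = 0 ∧ q₂ = p₂ ∧ G = F ∧
      ((s : Real.Angle) = (t : Real.Angle) ∨
        (s : Real.Angle) = ((Real.pi - t : ℝ) : Real.Angle))) := by
  have hNW : ∀ {s : ℝ} (F : M2), ((s : Real.Angle) = (t : Real.Angle) ∨
      (s : Real.Angle) = ((Real.pi - t : ℝ) : Real.Angle)) → NW 0 p₂ s F = NW 0 p₂ t F := by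
    rintro s F (hs | hs)
    · exact NW_congr (cos_sin_eq_of_coe_eq hs).1 (cos_sin_eq_of_coe_eq hs).2 _ _ _
    · rw [NW_congr (cos_sin_eq_of_coe_eq hs).1 (cos_sin_eq_of_coe_eq hs).2, NW_zero_left_pi_sub]
  constructor
  · intro h'
    have hadd := h.add_eq h'
    have hq₁ : q₁ = 0 := by
      rw [h'.left_eq_zero_iff, hadd]
      exact h.left_eq_zero_iff.1 rfl
    have hq₂ : q₂ = p₂ := by linarith
    subst hq₁ hq₂
    have hmem := h.CD_subset_tangentDisk h'.boundary_mem
    simp only [zero_add] at hmem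
    -- The maximal disk may touch the curve at two angles, but they share their sine: only `t` and
    -- `π - t` remain.
    have hsin := sin_eq_of_boundary_mem h₂ (by simpa using h.lt_pi) hmem
    have hs : (s : Real.Angle) = (t : Real.Angle) ∨
        (s : Real.Angle) = ((Real.pi - t : ℝ) : Real.Angle) := by
      rcases Real.Angle.sin_eq_iff_coe_eq_or_add_eq_pi.1 hsin.symm with h1 | h1
      · exact Or.inl h1
      · right
        rw [Real.Angle.coe_sub, ← h1, add_sub_cancel_right]
    refine ⟨rfl, rfl, eq_of_NW_eq h₂ (t := t) (p₁ := 0) ?_, hs⟩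
    rw [← h.eq_NW, ← hNW G hs, ← h'.eq_NW]
  · rintro ⟨rfl, rfl, rfl, hs⟩
    exact ⟨le_rfl, h₂.le, h.lt_pi, h.mem_KK, by rw [hNW G hs, ← h.eq_NW]⟩

end Presents

/-! ### The smallest radius -/

theorem exists_radius {A : M2} (hA : CD A ⊆ Complex.exp '' Metric.ball (0 : ℂ) Real.pi) :
    ∃ p, 0 ≤ p ∧ p < Real.pi ∧ CD A ⊆ expDisk p ∧ ∃ t, boundary p t ∈ CD A := by
  -- Logarithms of modulus below `π` have imaginary part below `π`, so `CD A` avoids the cut of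
  -- `log` and `‖log‖` attains its maximum on it.
  have hlog : ∀ z ∈ CD A, z ∈ Complex.slitPlane ∧ ‖Complex.log z‖ < Real.pi
      ∧ Complex.exp (Complex.log z) = z := by
    intro z hz
    obtain ⟨ζ, hζ, rfl⟩ := hA hz
    rw [mem_ball_zero_iff] at hζ
    refine ⟨?_, by rwa [log_exp_of_norm_lt_pi hζ], Complex.exp_log (Complex.exp_ne_zero ζ)⟩
    rw [Complex.mem_slitPlane_iff_arg]
    refine ⟨fun harg => ?_, Complex.exp_ne_zero ζ⟩
    rw [← Complex.log_im, log_exp_of_norm_lt_pi hζ] at harg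
    have := (Complex.abs_im_le_norm ζ).trans_lt hζ
    rw [harg, abs_of_pos Real.pi_pos] at this
    exact lt_irrefl _ this
  have hne : (CD A).Nonempty := ⟨_, Metric.mem_closedBall_self (chiralRadius_nonneg A)⟩
  obtain ⟨z, hz, hmax⟩ := (isCompact_closedBall _ _ : IsCompact (CD A)).exists_isMaxOn hne
    (f := fun z => ‖Complex.log z‖)
    (fun z hz => (continuousAt_clog (hlog z hz).1).norm.continuousWithinAt)
  refine ⟨‖Complex.log z‖, norm_nonneg _, (hlog z hz).2.1, fun x hx => ?_, ?_⟩
  · exact ⟨Complex.log x, mem_closedBall_zero_iff.2 (hmax hx), (hlog x hx).2.2⟩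
  · obtain ⟨t, ht⟩ := exists_eq_norm_mul_dir (Complex.log z)
    refine ⟨t, ?_⟩
    rw [boundary, ← ht, (hlog z hz).2.2]
    exact hz

theorem exists_eq_NW {A : M2} {p t : ℝ} (hp : 0 ≤ p) (hpi : p < Real.pi)
    (h : CD A ⊆ expDisk p) (ht : boundary p t ∈ CD A) :
    ∃ (p₁ p₂ : ℝ) (F : M2), 0 ≤ p₁ ∧ 0 ≤ p₂ ∧ p = p₁ + p₂ ∧ F ∈ KK ∧ A = NW p₁ p₂ t F := by
  obtain ⟨F, hF, hAF⟩ := exists_eq_conf_add A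
  obtain ⟨hc, hr⟩ := tangent_of_subset_expDisk hp hpi (chiralRadius_nonneg A) h ht
  obtain ⟨p₁, p₂, h₁, h₂, rfl, hrad⟩ := exists_nwRadius_eq hp (chiralRadius_nonneg A) hr
  refine ⟨p₁, p₂, F, h₁, h₂, rfl, hF, ?_⟩
  rw [NW_eq_conf_add, hrad]
  conv_lhs => rw [hAF, hc]

end MagnusGL2

/-! ### Assembly of the main theorem -/

open MagnusGL2 in
theorem mainTheorem10 (A : MagnusGL2.M2)
    (hA : MagnusGL2.CD A ⊆ Complex.exp '' Metric.ball (0 : ℂ) Real.pi) :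
    ∃ p : ℝ, IsLeast {r : ℝ | MagnusGL2.CD A ⊆ MagnusGL2.expDisk r} p ∧
      -- the chiral disk touches the boundary curve at some angle `t`
      (∃ t : ℝ, Complex.exp (p * (Real.cos t + Real.sin t * Complex.I)) ∈ MagnusGL2.CD A) ∧
      -- existence of the normal form, for every touching angle `t`
      (∀ t : ℝ, Complex.exp (p * (Real.cos t + Real.sin t * Complex.I)) ∈ MagnusGL2.CD A →
        ∃ (p₁ p₂ : ℝ) (F : MagnusGL2.M2),
          0 ≤ p₁ ∧ 0 ≤ p₂ ∧ p = p₁ + p₂ ∧ F ∈ MagnusGL2.KK ∧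
          A = MagnusGL2.NW p₁ p₂ t F ∧
          A = MagnusGL2.leftExp (MagnusGL2.uniformDensity p₁ p₂ t F) (-1 / 2) (1 / 2) ∧
          A = MagnusGL2.leftExp (MagnusGL2.ellipticDensity t) 0 p₁ *
              MagnusGL2.leftExp (MagnusGL2.developmentDensity t (-p₁ - p₂) F) 0 p₂ ∧
          A = MagnusGL2.leftExp (MagnusGL2.developmentDensity t (p₁ - p₂) F) 0 p₂ *
              MagnusGL2.leftExp (MagnusGL2.ellipticDensity t) 0 p₁ ∧
          -- the total variations, and the nature of the two parts
          MagnusGL2.variation (MagnusGL2.uniformDensity p₁ p₂ t F) (-1 / 2) (1 / 2) = p ∧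
          MagnusGL2.variation (MagnusGL2.ellipticDensity t) 0 p₁ = p₁ ∧
          MagnusGL2.variation (MagnusGL2.developmentDensity t (-p₁ - p₂) F) 0 p₂ = p₂ ∧
          MagnusGL2.variation (MagnusGL2.developmentDensity t (p₁ - p₂) F) 0 p₂ = p₂ ∧
          MagnusGL2.leftExp (MagnusGL2.ellipticDensity t) 0 p₁ =
            NormedSpace.exp (p₁ • NormedSpace.exp (t • MagnusGL2.tI)) ∧
          MagnusGL2.IsDevelopment (Real.sin t)
            (MagnusGL2.developmentDensity t (-p₁ - p₂) F) ∧
          MagnusGL2.IsDevelopment (Real.sin t)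
            (MagnusGL2.developmentDensity t (p₁ - p₂) F)) ∧
      -- the special cases and uniqueness
      (∀ (p₁ p₂ t : ℝ) (F : MagnusGL2.M2), MagnusGL2.Presents A p₁ p₂ t F →
        ((p₁ = 0 ∧ p₂ = 0) ↔ A = 1) ∧
        ((0 < p₁ ∧ p₂ = 0) ↔ (A ≠ 1 ∧ ∃ z : ℂ, MagnusGL2.CD A = {z})) ∧
        (p₂ = 0 → ∀ F' ∈ MagnusGL2.KK, A = MagnusGL2.NW p₁ p₂ t F') ∧
        ((p₁ = 0 ∧ 0 < p₂) ↔
          (A ≠ 1 ∧ MagnusGL2.IsMaximalDisk (MagnusGL2.CD A) (MagnusGL2.expDisk p))) ∧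
        (p₁ = 0 → 0 < p₂ → ∀ (q₁ q₂ s : ℝ) (G : MagnusGL2.M2),
          MagnusGL2.Presents A q₁ q₂ s G ↔
            (q₁ = 0 ∧ q₂ = p₂ ∧ G = F ∧
              ((s : Real.Angle) = (t : Real.Angle) ∨
                (s : Real.Angle) = ((Real.pi - t : ℝ) : Real.Angle)))) ∧
        (0 < p₁ → 0 < p₂ → ∀ (q₁ q₂ s : ℝ) (G : MagnusGL2.M2),
          MagnusGL2.Presents A q₁ q₂ s G →
            q₁ = p₁ ∧ q₂ = p₂ ∧ (s : Real.Angle) = (t : Real.Angle) ∧ G = F)) := by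
  obtain ⟨p, hp, hpi, hsub, t₀, ht₀⟩ := exists_radius hA
  refine ⟨p, ⟨hsub, fun r hr => le_of_boundary_mem_expDisk hp hpi (hr ht₀)⟩, ⟨t₀, ht₀⟩,
    fun t ht => ?_, fun p₁ p₂ t F h => ?_⟩
  · obtain ⟨p₁, p₂, F, h₁, h₂, hsum, hF, hA⟩ := exists_eq_NW hp hpi hsub ht
    exact ⟨p₁, p₂, F, h₁, h₂, hsum, hF, hA,
      hA.trans (NW_eq_leftExp_uniformDensity p₁ p₂ t hF),
      hA.trans (NW_eq_elliptic_mul_development t hF h₁ h₂),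
      hA.trans (NW_eq_development_mul_elliptic t hF h₁ h₂),
      (variation_uniformDensity h₁ h₂ t hF).trans hsum.symm,
      variation_ellipticDensity t p₁,
      variation_developmentDensity t _ p₂ hF,
      variation_developmentDensity t _ p₂ hF,
      leftExp_ellipticDensity t h₁,
      isDevelopment_developmentDensity t _ hF,
      isDevelopment_developmentDensity t _ hF⟩
  -- Every presentation has sum `p`, so maximality in `expDisk p` is maximality in `expDisk (p₁ +
  -- p₂)`.
  · have hpe : p = p₁ + p₂ :=
      le_antisymm (le_of_boundary_mem_expDisk hp hpi (h.CD_subset ht₀))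
        (le_of_boundary_mem_expDisk (add_nonneg h.nonneg_left h.nonneg_right) h.lt_pi
          (hsub h.boundary_mem))
    refine ⟨h.eq_zero_iff, ?_, ?_, ?_, ?_, fun h₁ h₂ q₁ q₂ s G h' => h.unique h₁ h₂ h'⟩
    · rw [← h.right_eq_zero_iff, Ne, ← h.eq_zero_iff]
      refine ⟨fun ⟨h₁, h₂⟩ => ⟨fun h0 => h₁.ne' h0.1, h₂⟩, fun ⟨h0, h₂⟩ => ⟨?_, h₂⟩⟩
      exact lt_of_le_of_ne h.nonneg_left fun h₁ => h0 ⟨h₁.symm, h₂⟩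
    · rintro rfl F' -
      rw [h.eq_NW]
      exact NW_zero_right p₁ t F F'
    · rw [hpe, ← h.left_eq_zero_iff, Ne, ← h.eq_zero_iff]
      refine ⟨fun ⟨h₁, h₂⟩ => ⟨fun h0 => h₂.ne' h0.2, h₁⟩, fun ⟨h0, h₁⟩ => ⟨h₁, ?_⟩⟩
      exact lt_of_le_of_ne h.nonneg_right fun h₂ => h0 ⟨h₁, h₂.symm⟩
    · rintro rfl h₂ q₁ q₂ s G
      exact h.iff_of_left_eq_zero h₂ q₁ q₂ s G
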